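/- Work over $\mathbb{C}$, with forms $P\,dx+Q\,dy$, where $P,Q\in\mathbb{C}[x,y,z]$ are homogeneous of degree $3$; polynomials in $x,y$ are homogenized with respect to $z$. A homogeneous $F\neq 0$ defines an integral curve of $P\,dx+Q\,dy$, with cofactor $K$, if $PF_y-QF_x=-FK$ with $K$ homogeneous of degree $2$. The form is Darboux integrable with respect to integral curves $F_1,\dots,F_r$ with cofactors $K_1,\dots,K_r$ if $Q_x-P_y=\sum_i\alpha_iK_i$ for some $\alpha_i\in\mathbb{C}$. It is a Poincaré form if at $(0:0:1)$ one has $P=Q=0$, $P_x=Q_y=1$ and $P_y=Q_x=0$. Let $T_2=ax^2+bxy+cy^2+dx+ey+1$ and, for parameters $\theta=(a,b,c,d,e,k,l,m,n,p,q)\in\mathbb{C}^{11}$, let $\omega_\theta=P\,dx+Q\,dy$ be the (homogenized) form with $$P=-\bigl(-y(ky+lx)-(py+qx)T_2-(2ax+by+d)(-qx^2+(n-p)xy+my^2)\bigr),$$ $$Q=-x(ky+lx)-(my+nx)T_2+(bx+2cy+e)(-qx^2+(n-p)xy+my^2).$$ Let $Y_{CR16}$ (Żołądek's family $CR_{16}$)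 be the set of all forms that arise from some $\omega_\theta$ by an invertible affine change of the coordinates $x,y$, and let $X_{CR16}$ be the set of Poincaré forms in $Y_{CR16}$. Let $X_{(2,1,1)}$ be the set of Poincaré forms of degree $3$ that have three smooth integral curves of degrees $2,1,1$ such that no curve is tangent to the line at infinity $z=0$, no two are tangent to each other, no two meet the line at infinity in the same point, and the three have no common point; let $\overline{X_{(2,1,1)}}$ be its Zariski closure in the affine space of Poincaré forms of degree $3$. **Proposition.** (1) There is a nonempty Zariski open set of parameters $\theta\in\mathbb{C}^{11}$ for which the following holds: the equation $$(mq-np)T_2+(kq-lp)x-(kn-lm)y=0$$ defines a smooth conic which is an integral curve of $\omega_\theta$; there are two distinct lines $L_1=0$, $L_2=0$ with $L_1L_2=qx^2+(p-n)xy-my^2$ that are integral curves of $\omega_\theta$; and $\omega_\theta$ is Darboux integrable with respect to the conic and these two lines. (2) $X_{CR16}\subset\overline{X_{(2,1,1)}}$. -/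

import Mathlib

open MvPolynomial

namespace PoincareCenter

/-- The homogeneous coordinate ring `ℂ[x, y, z]` of the projective plane, with `x = X 0`,
`y = X 1`, `z = X 2`. The line at infinity is `z = 0`. -/
abbrev Poly : Type := MvPolynomial (Fin 3) ℂ

/-- A differential form `P dx + Q dy`, recorded as the pair `(P, Q)`. -/
abbrev Form : Type := Poly × Poly

/-- `V d`: the forms `P dx + Q dy` with `P`, `Q` homogeneous of degree `d`. -/
noncomputable def V (d : ℕ) : Submodule ℂ Form :=
  (homogeneousSubmodule (Fin 3) ℂ d).prod (homogeneousSubmodule (Fin 3) ℂ d)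

/-- The origin `(0 : 0 : 1)` of the affine plane. -/
def origin : Fin 3 → ℂ := ![0, 0, 1]

/-- The Poincaré differential forms of degree `d`. -/
def poincareForms (d : ℕ) : Set Form :=
  {ω | ω ∈ V d ∧
    eval origin ω.1 = 0 ∧ eval origin ω.2 = 0 ∧
    eval origin (pderiv 0 ω.1) = 1 ∧ eval origin (pderiv 1 ω.2) = 1 ∧
    eval origin (pderiv 1 ω.1) = 0 ∧ eval origin (pderiv 0 ω.2) = 0}

/-- `K` is a cofactor of the curve `F = 0` for the degree `d` form `ω = P dx + Q dy`:
`K` is homogeneous of degree `d - 1` and `P F_y - Q F_x = - F K`. -/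
def IsCofactor (d : ℕ) (ω : Form) (F K : Poly) : Prop :=
  K.IsHomogeneous (d - 1) ∧ ω.1 * pderiv 1 F - ω.2 * pderiv 0 F = -(F * K)

/-- The curve `F = 0` is an (algebraic) integral curve of the degree `d` form `ω`. -/
def IsIntegralCurve (d : ℕ) (ω : Form) (F : Poly) : Prop :=
  F ≠ 0 ∧ ∃ K : Poly, IsCofactor d ω F K

/-- The degree `d` form `ω = P dx + Q dy` is Darboux integrable with respect to the integral
curves `F i = 0`: there are scalars `α i` such that `Q_x - P_y = ∑ α i K i`, where `K i` is the
cofactor of `F i`. -/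
def IsDarbouxIntegrableWith (d : ℕ) (ω : Form) {r : ℕ} (F : Fin r → Poly) : Prop :=
  (∀ i, F i ≠ 0) ∧
    ∃ (K : Fin r → Poly) (α : Fin r → ℂ), (∀ i, IsCofactor d ω (F i) (K i)) ∧
      pderiv 0 ω.2 - pderiv 1 ω.1 = ∑ i, C (α i) * K i

/-- The gradient `(F_x, F_y, F_z)` of `F` at the point `v`. -/
noncomputable def grad (F : Poly) (v : Fin 3 → ℂ) : Fin 3 → ℂ :=
  fun i => eval v (pderiv i F)

/-- The projective plane curve `F = 0` is smooth. -/
def IsSmoothCurve (F : Poly) : Prop :=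
  ∀ v : Fin 3 → ℂ, v ≠ 0 → eval v F = 0 → grad F v ≠ 0

/-- The general position conditions on the projective plane curves `F i = 0`: every curve is
smooth and not tangent to the line at infinity, no two curves are tangent to each other or meet
the line at infinity in the same point, and no three curves pass through the same point. -/
structure InGeneralPosition {r : ℕ} (F : Fin r → Poly) : Prop where
  smooth : ∀ i, IsSmoothCurve (F i)
  transversal_infinity : ∀ i, ∀ v : Fin 3 → ℂ, v ≠ 0 → v 2 = 0 → eval v (F i) = 0 →
    LinearIndependent ℂ ![grad (F i) v, grad (X 2) v]
  transversal : ∀ i j, i ≠ j → ∀ v : Fin 3 → ℂ, v ≠ 0 → eval v (F i) = 0 → eval v (F j) = 0 →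
    LinearIndependent ℂ ![grad (F i) v, grad (F j) v]
  disjoint_infinity : ∀ i j, i ≠ j → ∀ v : Fin 3 → ℂ, v ≠ 0 → v 2 = 0 →
    ¬ (eval v (F i) = 0 ∧ eval v (F j) = 0)
  no_triple_point : ∀ i j k, i ≠ j → i ≠ k → j ≠ k → ∀ v : Fin 3 → ℂ, v ≠ 0 →
    ¬ (eval v (F i) = 0 ∧ eval v (F j) = 0 ∧ eval v (F k) = 0)

/-- `Y_λ`: the forms of degree `d` with integral curves of degrees `deg i` in general position
(used when the `deg i` form a partition of `d + 1`). -/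
def YDarboux (d : ℕ) {r : ℕ} (deg : Fin r → ℕ) : Set Form :=
  {ω | ω ∈ V d ∧ ∃ F : Fin r → Poly, (∀ i, (F i).IsHomogeneous (deg i)) ∧
    InGeneralPosition F ∧ ∀ i, IsIntegralCurve d ω (F i)}

/-- `X_λ`: the Poincaré differential forms in `Y_λ`. -/
def XDarboux (d : ℕ) {r : ℕ} (deg : Fin r → ℕ) : Set Form :=
  YDarboux d deg ∩ poincareForms d

/-- The coordinates of a form: the coefficients of `P` (index `Sum.inl`) and of `Q`
(index `Sum.inr`). -/
noncomputable def coords (ω : Form) : (Fin 3 →₀ ℕ) ⊕ (Fin 3 →₀ ℕ) → ℂ :=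
  Sum.elim (fun s => coeff s ω.1) (fun s => coeff s ω.2)

/-- The Zariski closure: all Poincaré forms of degree `d` at which every polynomial in the
coefficients that vanishes on `S` vanishes. -/
def zariskiClosure (d : ℕ) (S : Set Form) : Set Form :=
  {ω | ω ∈ poincareForms d ∧ ∀ f : MvPolynomial ((Fin 3 →₀ ℕ) ⊕ (Fin 3 →₀ ℕ)) ℂ,
    (∀ η ∈ S, eval (coords η) f = 0) → eval (coords ω) f = 0}

/-- The names of the eleven parameters of the family. -/
inductive Param
  | a | b | c | d | e | k | l | m | n | p | q

namespace CR16

variable (θ : Param → ℂ)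

/-- `T₂ = a x² + b x y + c y² + d x + e y + 1`, homogenized. -/
noncomputable def T₂ : Poly :=
  C (θ .a) * X 0 ^ 2 + C (θ .b) * X 0 * X 1 + C (θ .c) * X 1 ^ 2
    + C (θ .d) * X 0 * X 2 + C (θ .e) * X 1 * X 2 + X 2 ^ 2

/-- The homogenized differential form of the family `CR₁₆` with parameters `θ`. -/
noncomputable def form : Form :=
  ( -(-X 1 * (C (θ .k) * X 1 + C (θ .l) * X 0) * X 2
        - (C (θ .p) * X 1 + C (θ .q) * X 0) * T₂ θ
        - (2 * C (θ .a) * X 0 + C (θ .b) * X 1 + C (θ .d) * X 2)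
          * (-C (θ .q) * X 0 ^ 2 + (C (θ .n) - C (θ .p)) * X 0 * X 1 + C (θ .m) * X 1 ^ 2)),
    -X 0 * (C (θ .k) * X 1 + C (θ .l) * X 0) * X 2
        - (C (θ .m) * X 1 + C (θ .n) * X 0) * T₂ θ
        + (C (θ .b) * X 0 + 2 * C (θ .c) * X 1 + C (θ .e) * X 2)
          * (-C (θ .q) * X 0 ^ 2 + (C (θ .n) - C (θ .p)) * X 0 * X 1 + C (θ .m) * X 1 ^ 2) )

/-- The conic `(mq - np) T₂ + (kq - lp) x - (kn - lm) y`, homogenized. -/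
noncomputable def conic : Poly :=
  C (θ .m * θ .q - θ .n * θ .p) * T₂ θ
    + C (θ .k * θ .q - θ .l * θ .p) * X 0 * X 2
    - C (θ .k * θ .n - θ .l * θ .m) * X 1 * X 2

/-- The pair of lines `q x² + (p - n) x y - m y²`. -/
noncomputable def linePair : Poly :=
  C (θ .q) * X 0 ^ 2 + C (θ .p - θ .n) * X 0 * X 1 - C (θ .m) * X 1 ^ 2

end CR16

/-- The pullback of the form `ω = P dx + Q dy` under the affine map
`(x, y) ↦ (A₀₀ x + A₀₁ y + t₀, A₁₀ x + A₁₁ y + t₁)`, in homogeneous coordinates. -/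
noncomputable def affinePullback (A : Matrix (Fin 2) (Fin 2) ℂ) (t : Fin 2 → ℂ) (ω : Form) :
    Form :=
  let σ : Poly →ₐ[ℂ] Poly := aeval
    ![C (A 0 0) * X 0 + C (A 0 1) * X 1 + C (t 0) * X 2,
      C (A 1 0) * X 0 + C (A 1 1) * X 1 + C (t 1) * X 2,
      X 2]
  (C (A 0 0) * σ ω.1 + C (A 1 0) * σ ω.2, C (A 0 1) * σ ω.1 + C (A 1 1) * σ ω.2)

/-- The family `CR₁₆`, as a set of forms: all forms that are given by the normal form
`CR16.form θ` in some affine coordinate system. -/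
def YCR16 : Set Form :=
  {ω | ∃ (θ : Param → ℂ) (A : Matrix (Fin 2) (Fin 2) ℂ) (t : Fin 2 → ℂ),
    A.det ≠ 0 ∧ ω = affinePullback A t (CR16.form θ)}

/-- The Poincaré differential forms in the family `CR₁₆`. -/
def XCR16 : Set Form := YCR16 ∩ poincareForms 3

end PoincareCenter

/-!
Write `T = T₂`, `D = mq - np`, `u = q x + p y`, `v = n x + m y`, `s = k y + l x`, `β = u dx - v dy`,
`R = y v - x u = -linePair` and `η = y dx - x dy`. Then `ω_θ = T β + R dT + s z η`, and the conic is
`F = D T + ℓ z` with `ℓ = k (q x - n y) - l (p x - m y)`. Since `ℓ β + R dℓ = D s η`, this gives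
`D ω_θ = F β + R dF`: so `F` is an integral curve. A linear factor `L` of `R` is one because it
divides `β ∧ dL`, and the three cofactors add up to `Q_x - P_y`, that is, `1 / (F L₁ L₂)` is an
integrating factor (`CR16.isCofactor_conic`, `CR16.isCofactor_line`,
`CR16.pderiv_sub_eq_sum_cofactors`). All general position conditions follow from the non-vanishing
of one polynomial in the parameters, `CR16.genericity`, a product of discriminants and resultants
(`CR16.inGeneralPosition`). This proves the first part.

For the second part, consider a Poincaré form that is the pullback of `ω_θ` by an affine map sending
the origin to `t`. Then `ω_θ` vanishes at `t` and its linear part there, a bilinear form, is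
symmetric and nondegenerate. The normal forms are stable under linear substitutions, so `t` may be
taken to be `(0, 0)` or `(1, 0)` (`CR16.exists_normalized`). The parameters for which `ω_θ` vanishes
at `t` with symmetric linear part then form explicit families, each of which is parametrized by
polynomials in free variables: `p = -n` for `t = (0, 0)`, and for `t = (1, 0)` either `a = 1` or
`q = 0`, `p = 2 n`, with `l` determined by the other parameters in both of the latter cases. In the
first and the last family `t` lies on one of the lines, so that these forms need not be limits of
forms from the remaining family; but each of the three families contains generic parameters. Hence
there is a polynomial path in the family from `θ` to a generic parameter, and all but finitely many
of its points are generic. A Gram–Schmidt correction, continuous near the start of the path, makes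
the linear part the identity again, so the given form is a limit of forms in
`XDarboux 3 ![2, 1, 1]` (`mem_zariskiClosure_of_path`). A polynomial in the coefficients is continuous, so it
vanishes at the limit if it vanishes on `XDarboux 3 ![2, 1, 1]`.
-/

namespace PoincareCenter

/-! ### Linear forms and binary quadratic forms -/

/-- The linear form `α x + β y`: a line through the origin of the affine plane. -/
noncomputable def lineForm (α β : ℂ) : Poly := C α * X 0 + C β * X 1

theorem pderiv_two (i : Fin 3) : pderiv i (2 : Poly) = 0 := by
  simpa only [map_ofNat] using pderiv_C (R := ℂ) (a := 2) (i := i)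

theorem isHomogeneous_lineForm (α β : ℂ) : (lineForm α β).IsHomogeneous 1 :=
  (isHomogeneous_C_mul_X _ _).add (isHomogeneous_C_mul_X _ _)

@[simp]
theorem eval_lineForm (α β : ℂ) (v : Fin 3 → ℂ) :
    eval v (lineForm α β) = α * v 0 + β * v 1 := by
  simp [lineForm]

theorem pderiv_zero_lineForm (α β : ℂ) : pderiv 0 (lineForm α β) = C α := by
  simp [lineForm]

theorem pderiv_one_lineForm (α β : ℂ) : pderiv 1 (lineForm α β) = C β := by
  simp [lineForm]

theorem pderiv_two_lineForm (α β : ℂ) : pderiv 2 (lineForm α β) = 0 := by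
  simp [lineForm]

theorem grad_lineForm (α β : ℂ) (v : Fin 3 → ℂ) : grad (lineForm α β) v = ![α, β, 0] := by
  funext i
  fin_cases i <;>
    simp [grad, pderiv_zero_lineForm, pderiv_one_lineForm, pderiv_two_lineForm]

theorem grad_X_two (v : Fin 3 → ℂ) : grad (X 2) v = ![0, 0, 1] := by
  funext i
  fin_cases i <;> simp [grad]

theorem lineForm_ne_zero {α β γ δ : ℂ} (h : α * δ - γ * β ≠ 0) : lineForm α β ≠ 0 := by
  intro h0
  have h1 := congrArg (eval ![1, 0, 0]) h0
  have h2 := congrArg (eval ![0, 1, 0]) h0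
  simp at h1 h2
  simp [h1, h2] at h

theorem linearIndependent_lineForm {α β γ δ : ℂ} (h : α * δ - γ * β ≠ 0) :
    LinearIndependent ℂ ![lineForm α β, lineForm γ δ] := by
  rw [LinearIndependent.pair_iff]
  intro s t hst
  have h1 := congrArg (eval ![1, 0, 0]) hst
  have h2 := congrArg (eval ![0, 1, 0]) hst
  simp [smul_eval] at h1 h2
  have hs : s * (α * δ - γ * β) = 0 := by linear_combination δ * h1 - γ * h2
  have ht : t * (α * δ - γ * β) = 0 := by linear_combination α * h2 - β * h1
  exact ⟨(mul_eq_zero.1 hs).resolve_right h, (mul_eq_zero.1 ht).resolve_right h⟩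

/-- A binary quadratic form over `ℂ` is a product of two linear forms. -/
theorem exists_binary_factorization (q r m : ℂ) :
    ∃ α β γ δ : ℂ, q = α * γ ∧ r = α * δ + γ * β ∧ m = β * δ := by
  by_cases hq : q = 0
  · exact ⟨0, 1, r, m, by simp [hq], by ring, by ring⟩
  · obtain ⟨s, hs⟩ := IsAlgClosed.exists_pow_nat_eq (r ^ 2 - 4 * q * m) (n := 2) (by norm_num)
    refine ⟨q, (r + s) / 2, 1, (r - s) / (2 * q), by ring, by field_simp; ring, ?_⟩
    field_simp
    linear_combination hs

/-- The resultant of the binary quadratic forms `A x² + B x y + C y²` and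
`A' x² + B' x y + C' y²`. -/
def quadResultant {R : Type*} [CommRing R] (A B C A' B' C' : R) : R :=
  (A * C' - A' * C) ^ 2 - (A * B' - A' * B) * (B * C' - B' * C)

theorem eq_zero_of_quadResultant_ne_zero {A B C A' B' C' x y : ℂ}
    (h : quadResultant A B C A' B' C' ≠ 0) (h1 : A * x ^ 2 + B * x * y + C * y ^ 2 = 0)
    (h2 : A' * x ^ 2 + B' * x * y + C' * y ^ 2 = 0) : x = 0 ∧ y = 0 := by
  have hxy : quadResultant A B C A' B' C' * (x ^ 2 * y) = 0 := by
    unfold quadResultant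
    linear_combination ((A * C' - A' * C) * y * C' + (B * C' - B' * C) * x * A') * h1 -
      ((A * C' - A' * C) * y * C + (B * C' - B' * C) * x * A) * h2
  have hxy' : x ^ 2 = 0 ∨ y = 0 := by simpa [h] using hxy
  rcases hxy' with hx | hy
  · obtain rfl : x = 0 := by simpa using hx
    refine ⟨rfl, by_contra fun hy => h ?_⟩
    simp [hy] at h1 h2
    simp [quadResultant, h1, h2]
  · subst hy
    refine ⟨by_contra fun hx => h ?_, rfl⟩
    simp [hx] at h1 h2
    simp [quadResultant, h1, h2]

namespace CR16

/-! ### The genericity polynomial -/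

section Genericity

variable {R : Type*} [CommRing R] (θ : Param → R)

/-- The determinant `mq - np`, which is the coefficient of `z²` in the conic. -/
def coeffD : R := θ .m * θ .q - θ .n * θ .p

/-- The coefficient of `x z` in the conic. -/
def coeffXZ : R := coeffD θ * θ .d + (θ .k * θ .q - θ .l * θ .p)

/-- The coefficient of `y z` in the conic. -/
def coeffYZ : R := coeffD θ * θ .e - (θ .k * θ .n - θ .l * θ .m)

/-- The discriminant of the pair of lines. -/
def lineDiscr : R := (θ .p - θ .n) ^ 2 + 4 * θ .m * θ .q

/-- The discriminant of the leading form `a x² + b x y + c y²`, up to sign. -/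
def infinityDiscr : R := 4 * θ .a * θ .c - θ .b ^ 2

/-- Half the determinant of the matrix of second derivatives of the conic. -/
def conicDiscr : R :=
  4 * (coeffD θ * θ .a) * (coeffD θ * θ .c) * coeffD θ
    + (coeffD θ * θ .b) * coeffXZ θ * coeffYZ θ
    - (coeffD θ * θ .a) * coeffYZ θ ^ 2 - (coeffD θ * θ .c) * coeffXZ θ ^ 2
    - coeffD θ * (coeffD θ * θ .b) ^ 2

/-- The resultant of the leading form of the conic and the pair of lines; it vanishes when the conic
meets one of the lines at infinity. -/
def infinityResultant : R :=
  quadResultant (θ .a) (θ .b) (θ .c) (θ .q) (θ .p - θ .n) (-θ .m)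

/-- The restriction of the conic to the line spanned by the direction `w` has discriminant
`(coeffXZ w₀ + coeffYZ w₁)² - 4 D² (a w₀² + b w₀ w₁ + c w₁²)`. This is the resultant of that
quadratic form in `w` and the pair of lines; it vanishes when one of the lines is tangent to the
conic. -/
def tangencyResultant : R :=
  quadResultant (coeffXZ θ ^ 2 - 4 * coeffD θ ^ 2 * θ .a)
    (2 * coeffXZ θ * coeffYZ θ - 4 * coeffD θ ^ 2 * θ .b)
    (coeffYZ θ ^ 2 - 4 * coeffD θ ^ 2 * θ .c) (θ .q) (θ .p - θ .n) (-θ .m)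

/-- The polynomial in the parameters whose non-vanishing puts the conic and the two lines in
general position. -/
def genericity : R :=
  coeffD θ * lineDiscr θ * infinityDiscr θ * conicDiscr θ * infinityResultant θ
    * tangencyResultant θ

theorem map_genericity {S : Type*} [CommRing S] (f : R →+* S) :
    f (genericity θ) = genericity (fun i => f (θ i)) := by
  simp only [genericity, coeffD, lineDiscr, infinityDiscr, conicDiscr, infinityResultant,
    tangencyResultant, quadResultant, coeffXZ, coeffYZ, map_add, map_sub, map_mul, map_pow,
    map_neg, map_ofNat]

end Genericity

variable (θ : Param → ℂ)

/-! ### The conic, the lines and their cofactors -/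

theorem T₂_isHomogeneous : (T₂ θ).IsHomogeneous 2 := by
  have hXX (r : ℂ) (i j : Fin 3) : (C r * X i * X j : Poly).IsHomogeneous 2 :=
    (isHomogeneous_C_mul_X r i).mul (isHomogeneous_X _ j)
  have hX2 (r : ℂ) (i : Fin 3) : (C r * X i ^ 2 : Poly).IsHomogeneous 2 :=
    isHomogeneous_C_mul_X_pow r i 2
  exact (((((hX2 _ _).add (hXX _ _ _)).add (hX2 _ _)).add (hXX _ _ _)).add (hXX _ _ _)).add
    (isHomogeneous_X_pow _ _)

theorem conic_isHomogeneous : (conic θ).IsHomogeneous 2 := by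
  have hXX (r : ℂ) (i j : Fin 3) : (C r * X i * X j : Poly).IsHomogeneous 2 :=
    (isHomogeneous_C_mul_X r i).mul (isHomogeneous_X _ j)
  exact (((T₂_isHomogeneous θ).C_mul _).add (hXX _ _ _)).sub (hXX _ _ _)

theorem form_mem_V : form θ ∈ V 3 := by
  have hX (r : ℂ) (i : Fin 3) : (C r * X i : Poly).IsHomogeneous 1 := isHomogeneous_C_mul_X r i
  have hN (i : Fin 3) : (-X i : Poly).IsHomogeneous 1 := (isHomogeneous_X ℂ i).neg
  have hz : (X 2 : Poly).IsHomogeneous 1 := isHomogeneous_X ℂ 2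
  have h2 (r : ℂ) (i : Fin 3) : (2 * C r * X i : Poly).IsHomogeneous 1 := by
    simpa only [map_mul, map_ofNat] using hX (2 * r) i
  have hR : (-C (θ .q) * X 0 ^ 2 + (C (θ .n) - C (θ .p)) * X 0 * X 1
      + C (θ .m) * X 1 ^ 2 : Poly).IsHomogeneous 2 := by
    rw [← map_neg, ← map_sub]
    exact ((isHomogeneous_C_mul_X_pow _ _ 2).add ((hX _ _).mul (isHomogeneous_X _ _))).add
      (isHomogeneous_C_mul_X_pow _ _ 2)
  have hT := T₂_isHomogeneous θ
  have hC (r r' : ℂ) (i j : Fin 3) : (C r * X i + C r' * X j : Poly).IsHomogeneous 1 :=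
    (hX r i).add (hX r' j)
  exact ⟨((((hN 1).mul (hC _ _ _ _)).mul hz).sub ((hC _ _ _ _).mul hT) |>.sub
      ((((h2 _ _).add (hX _ _)).add (hX _ _)).mul hR)).neg,
    (((hN 0).mul (hC _ _ _ _)).mul hz).sub ((hC _ _ _ _).mul hT) |>.add
      ((((hX _ _).add (h2 _ _)).add (hX _ _)).mul hR)⟩

theorem pderiv_zero_T₂ : pderiv 0 (T₂ θ) =
    C (2 * θ .a) * X 0 + C (θ .b) * X 1 + C (θ .d) * X 2 := by
  simp [T₂, map_ofNat C]
  ring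

theorem pderiv_one_T₂ : pderiv 1 (T₂ θ) =
    C (θ .b) * X 0 + C (2 * θ .c) * X 1 + C (θ .e) * X 2 := by
  simp [T₂, map_ofNat C]
  ring

theorem pderiv_zero_conic : pderiv 0 (conic θ) =
    C (coeffD θ) * (C (2 * θ .a) * X 0 + C (θ .b) * X 1 + C (θ .d) * X 2)
      + C (θ .k * θ .q - θ .l * θ .p) * X 2 := by
  simp [conic, pderiv_zero_T₂, coeffD]
  ring

theorem pderiv_one_conic : pderiv 1 (conic θ) =
    C (coeffD θ) * (C (θ .b) * X 0 + C (2 * θ .c) * X 1 + C (θ .e) * X 2)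
      - C (θ .k * θ .n - θ .l * θ .m) * X 2 := by
  simp [conic, pderiv_one_T₂, coeffD]
  ring

theorem eval_conic (v : Fin 3 → ℂ) : eval v (conic θ) =
    coeffD θ * (θ .a * v 0 ^ 2 + θ .b * v 0 * v 1 + θ .c * v 1 ^ 2)
      + (coeffXZ θ * v 0 + coeffYZ θ * v 1) * v 2 + coeffD θ * v 2 ^ 2 := by
  simp [conic, T₂, coeffXZ, coeffYZ, coeffD]
  ring

theorem grad_conic (v : Fin 3 → ℂ) : grad (conic θ) v =
    ![coeffD θ * (2 * θ .a * v 0 + θ .b * v 1) + coeffXZ θ * v 2,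
      coeffD θ * (θ .b * v 0 + 2 * θ .c * v 1) + coeffYZ θ * v 2,
      coeffXZ θ * v 0 + coeffYZ θ * v 1 + 2 * coeffD θ * v 2] := by
  funext i
  fin_cases i
  · simp [grad, pderiv_zero_conic, coeffXZ]
    ring
  · simp [grad, pderiv_one_conic, coeffYZ]
    ring
  · simp [grad, conic, T₂, coeffXZ, coeffYZ, coeffD]
    ring

/-- The cofactor of the conic: with `ω = T β + R dT + s z η`, `β = u dx - v dy`, it is
`-(u T_y + v T_x + s z)`. -/
noncomputable def conicCofactor : Poly :=
  -((C (θ .p) * X 1 + C (θ .q) * X 0) *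
      (C (θ .b) * X 0 + C (2 * θ .c) * X 1 + C (θ .e) * X 2)
    + (C (θ .m) * X 1 + C (θ .n) * X 0) *
      (C (2 * θ .a) * X 0 + C (θ .b) * X 1 + C (θ .d) * X 2)
    + (C (θ .k) * X 1 + C (θ .l) * X 0) * X 2)

theorem isCofactor_conic : IsCofactor 3 (form θ) (conic θ)
    (conicCofactor θ) := by
  have hX (r : ℂ) (i : Fin 3) : (C r * X i : Poly).IsHomogeneous 1 := isHomogeneous_C_mul_X r i
  refine ⟨(((((hX _ _).add (hX _ _)).mul (((hX _ _).add (hX _ _)).add (hX _ _))).add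
    (((hX _ _).add (hX _ _)).mul (((hX _ _).add (hX _ _)).add (hX _ _)))).add
    (((hX _ _).add (hX _ _)).mul (isHomogeneous_X _ _))).neg, ?_⟩
  rw [pderiv_zero_conic, pderiv_one_conic]
  simp only [form, conic, conicCofactor, T₂, coeffD, map_mul, map_sub, map_ofNat]
  ring

/-- The cofactor of one of the two lines, when the pair of lines is
`(α x + β y) (γ x + δ y)`. -/
noncomputable def lineCofactor (α β γ δ : ℂ) : Poly :=
  -(C (θ .n + γ * β) * T₂ θ + (C (θ .k) * X 1 + C (θ .l) * X 0) * X 2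
    - lineForm γ δ *
      (C β * (C (2 * θ .a) * X 0 + C (θ .b) * X 1 + C (θ .d) * X 2)
        - C α * (C (θ .b) * X 0 + C (2 * θ .c) * X 1 + C (θ .e) * X 2)))

variable {θ}

theorem isCofactor_line {α β γ δ : ℂ} (hq : θ .q = α * γ) (hr : θ .p - θ .n = α * δ + γ * β)
    (hm : -θ .m = β * δ) :
    IsCofactor 3 (form θ) (lineForm α β) (lineCofactor θ α β γ δ) := by
  have hX (r : ℂ) (i : Fin 3) : (C r * X i : Poly).IsHomogeneous 1 := isHomogeneous_C_mul_X r i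
  refine ⟨((((T₂_isHomogeneous θ).C_mul _).add
    (((hX _ _).add (hX _ _)).mul (isHomogeneous_X _ _))).sub
    ((isHomogeneous_lineForm _ _).mul
      (((((hX _ _).add (hX _ _)).add (hX _ _)).C_mul _).sub
        ((((hX _ _).add (hX _ _)).add (hX _ _)).C_mul _)))).neg, ?_⟩
  rw [pderiv_zero_lineForm, pderiv_one_lineForm]
  have hp' : θ .p = θ .n + (α * δ + γ * β) := by linear_combination hr
  have hm' : θ .m = -(β * δ) := by linear_combination -hm
  simp only [form, lineCofactor, lineForm, T₂, hq, hp', hm', map_mul, map_add, map_neg,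
    map_ofNat]
  ring

theorem linePair_eq {α β γ δ : ℂ} (hq : θ .q = α * γ) (hr : θ .p - θ .n = α * δ + γ * β)
    (hm : -θ .m = β * δ) : lineForm α β * lineForm γ δ = linePair θ := by
  have hm' : θ .m = -(β * δ) := by linear_combination -hm
  simp only [linePair, lineForm, hq, hr, hm', map_mul, map_add, map_neg]
  ring

/-- The reciprocal of the product of the conic and the two lines is an integrating factor. -/
theorem pderiv_sub_eq_sum_cofactors {α β γ δ : ℂ} (hq : θ .q = α * γ)
    (hr : θ .p - θ .n = α * δ + γ * β) (hm : -θ .m = β * δ) :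
    pderiv 0 (form θ).2 - pderiv 1 (form θ).1 =
      conicCofactor θ
      + lineCofactor θ α β γ δ + lineCofactor θ γ δ α β := by
  have hp' : θ .p = θ .n + (α * δ + γ * β) := by linear_combination hr
  have hm' : θ .m = -(β * δ) := by linear_combination -hm
  simp [form, pderiv_zero_T₂, pderiv_one_T₂, pderiv_two]
  simp only [conicCofactor, lineCofactor, lineForm, T₂, hq, hp', hm', map_mul, map_add, map_neg,
    map_ofNat]
  ring

end CR16
end PoincareCenter

namespace PoincareCenter

/-! ### General position of the conic and the lines -/

/-- For three curves, each symmetric condition only has to be checked once per pair, and there is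
only one triple. -/
theorem InGeneralPosition.of_three {F : Fin 3 → Poly} (hs : ∀ i, IsSmoothCurve (F i))
    (hinf : ∀ i, ∀ v : Fin 3 → ℂ, v ≠ 0 → v 2 = 0 → eval v (F i) = 0 →
      LinearIndependent ℂ ![grad (F i) v, grad (X 2) v])
    (ht : ∀ i j, i < j → ∀ v : Fin 3 → ℂ, v ≠ 0 → eval v (F i) = 0 → eval v (F j) = 0 →
      LinearIndependent ℂ ![grad (F i) v, grad (F j) v])
    (hd : ∀ i j, i < j → ∀ v : Fin 3 → ℂ, v ≠ 0 → v 2 = 0 →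
      ¬ (eval v (F i) = 0 ∧ eval v (F j) = 0))
    (h3 : ∀ v : Fin 3 → ℂ, v ≠ 0 → ¬ ∀ i, eval v (F i) = 0) : InGeneralPosition F where
  smooth := hs
  transversal_infinity := hinf
  transversal i j hij v hv hi hj := by
    rcases lt_or_gt_of_ne hij with h | h
    · exact ht i j h v hv hi hj
    · rw [LinearIndependent.pair_symm_iff]
      exact ht j i h v hv hj hi
  disjoint_infinity i j hij v hv hz := by
    rcases lt_or_gt_of_ne hij with h | h
    · exact hd i j h v hv hz
    · exact fun h' => hd j i h v hv hz h'.symm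
  no_triple_point i j k hij hik hjk v hv h := by
    refine h3 v hv fun l => ?_
    have hl : l = i ∨ l = j ∨ l = k := by omega
    rcases hl with rfl | rfl | rfl
    exacts [h.1, h.2.1, h.2.2]

/-- Two vectors are linearly independent if the second is nonzero and the first is not a multiple
of it. -/
theorem linearIndependent_of_forall_ne {u w : Fin 3 → ℂ} (hw : w ≠ 0)
    (h : ∀ μ : ℂ, u ≠ μ • w) : LinearIndependent ℂ ![u, w] := by
  rw [LinearIndependent.pair_symm_iff, LinearIndependent.pair_iff' hw]
  exact fun μ hμ => h μ hμ.symm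

theorem vec_ne_zero {v : Fin 3 → ℂ} (hv : v ≠ 0) : ¬ (v 0 = 0 ∧ v 1 = 0 ∧ v 2 = 0) := by
  rintro ⟨h0, h1, h2⟩
  exact hv (funext fun i => by fin_cases i <;> assumption)

theorem lineForm_isSmoothCurve {α β : ℂ} (h : α ≠ 0 ∨ β ≠ 0) : IsSmoothCurve (lineForm α β) := by
  intro v _ _ hg
  rw [grad_lineForm] at hg
  have h0 := congrFun hg 0
  have h1 := congrFun hg 1
  simp at h0 h1
  tauto

theorem lineForm_transversal_infinity {α β : ℂ} (h : α ≠ 0 ∨ β ≠ 0) (v : Fin 3 → ℂ) :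
    LinearIndependent ℂ ![grad (lineForm α β) v, grad (X 2) v] := by
  rw [grad_lineForm, grad_X_two]
  refine linearIndependent_of_forall_ne (fun h2 => by simpa using congrFun h2 2) fun μ hμ => ?_
  have h0 := congrFun hμ 0
  have h1 := congrFun hμ 1
  simp at h0 h1
  tauto

theorem lineForm_transversal_lineForm {α β γ δ : ℂ} (h : α * δ - γ * β ≠ 0) (v : Fin 3 → ℂ) :
    LinearIndependent ℂ ![grad (lineForm α β) v, grad (lineForm γ δ) v] := by
  rw [grad_lineForm, grad_lineForm, LinearIndependent.pair_iff]
  intro s t hst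
  have h1 := congrFun hst 0
  have h2 := congrFun hst 1
  simp at h1 h2
  have hs : s * (α * δ - γ * β) = 0 := by linear_combination δ * h1 - γ * h2
  have ht : t * (α * δ - γ * β) = 0 := by linear_combination α * h2 - β * h1
  exact ⟨(mul_eq_zero.1 hs).resolve_right h, (mul_eq_zero.1 ht).resolve_right h⟩

theorem eq_zero_of_mem_lines {α β γ δ : ℂ} (h : α * δ - γ * β ≠ 0) {v : Fin 3 → ℂ}
    (h1 : eval v (lineForm α β) = 0) (h2 : eval v (lineForm γ δ) = 0) : v 0 = 0 ∧ v 1 = 0 := by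
  rw [eval_lineForm] at h1 h2
  have hs : v 0 * (α * δ - γ * β) = 0 := by linear_combination δ * h1 - β * h2
  have ht : v 1 * (α * δ - γ * β) = 0 := by linear_combination α * h2 - γ * h1
  exact ⟨(mul_eq_zero.1 hs).resolve_right h, (mul_eq_zero.1 ht).resolve_right h⟩

namespace CR16

variable {θ : Param → ℂ}

theorem conic_isSmoothCurve (h : conicDiscr θ ≠ 0) : IsSmoothCurve (conic θ) := by
  intro v hv _ hg
  rw [grad_conic] at hg
  have h0 := congrFun hg 0
  have h1 := congrFun hg 1
  have h2 := congrFun hg 2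
  simp at h0 h1 h2
  have e0 : conicDiscr θ * v 0 * 2 = 0 := by
    unfold conicDiscr
    linear_combination (4 * coeffD θ * θ .c * coeffD θ - coeffYZ θ ^ 2) * h0
      + (coeffXZ θ * coeffYZ θ - 2 * coeffD θ * θ .b * coeffD θ) * h1
      + (coeffD θ * θ .b * coeffYZ θ - 2 * coeffD θ * θ .c * coeffXZ θ) * h2
  have e1 : conicDiscr θ * v 1 * 2 = 0 := by
    unfold conicDiscr
    linear_combination (coeffXZ θ * coeffYZ θ - 2 * coeffD θ * θ .b * coeffD θ) * h0
      + (4 * coeffD θ * θ .a * coeffD θ - coeffXZ θ ^ 2) * h1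
      + (coeffD θ * θ .b * coeffXZ θ - 2 * coeffD θ * θ .a * coeffYZ θ) * h2
  have e2 : conicDiscr θ * v 2 * 2 = 0 := by
    unfold conicDiscr
    linear_combination (coeffD θ * θ .b * coeffYZ θ - 2 * coeffD θ * θ .c * coeffXZ θ) * h0
      + (coeffD θ * θ .b * coeffXZ θ - 2 * coeffD θ * θ .a * coeffYZ θ) * h1
      + (4 * coeffD θ * θ .a * (coeffD θ * θ .c) - (coeffD θ * θ .b) ^ 2) * h2
  refine vec_ne_zero hv ⟨?_, ?_, ?_⟩
  · simpa [h] using e0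
  · simpa [h] using e1
  · simpa [h] using e2

theorem conic_transversal_infinity (hD : coeffD θ ≠ 0) (h : infinityDiscr θ ≠ 0)
    (v : Fin 3 → ℂ) (hv : v ≠ 0) (hz : v 2 = 0) :
    LinearIndependent ℂ ![grad (conic θ) v, grad (X 2) v] := by
  rw [grad_conic, grad_X_two]
  refine linearIndependent_of_forall_ne (fun h2 => by simpa using congrFun h2 2) fun μ hμ => ?_
  have h0 := congrFun hμ 0
  have h1 := congrFun hμ 1
  simp [hz, hD] at h0 h1
  have e0 : infinityDiscr θ * v 0 = 0 := by
    unfold infinityDiscr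
    linear_combination 2 * θ .c * h0 - θ .b * h1
  have e1 : infinityDiscr θ * v 1 = 0 := by
    unfold infinityDiscr
    linear_combination 2 * θ .a * h1 - θ .b * h0
  exact vec_ne_zero hv ⟨by simpa [h] using e0, by simpa [h] using e1, hz⟩

/-- The direction `(β, -α)` of the line `α x + β y = 0` is a root of the pair of lines. -/
theorem linePair_root {α β γ δ : ℂ} (hq : θ .q = α * γ) (hr : θ .p - θ .n = α * δ + γ * β)
    (hm : -θ .m = β * δ) : θ .q * β ^ 2 + (θ .p - θ .n) * β * (-α) + -θ .m * (-α) ^ 2 = 0 := by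
  rw [hq, hr, hm]
  ring

theorem exists_eq_smul_of_mem_line {α β : ℂ} (h : α ≠ 0 ∨ β ≠ 0) {v : Fin 3 → ℂ}
    (hv : eval v (lineForm α β) = 0) : ∃ s, v 0 = s * β ∧ v 1 = s * (-α) := by
  rw [eval_lineForm] at hv
  by_cases hβ : β = 0
  · have hα : α ≠ 0 := by tauto
    have h0 : v 0 = 0 := by simpa [hβ, hα] using hv
    exact ⟨-v 1 / α, by simp [h0, hβ], by field_simp⟩
  · exact ⟨v 0 / β, by field_simp, by field_simp; linear_combination hv⟩

/-- If the conic were tangent to the line `α x + β y = 0`, its restriction to the line, a quadratic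
form in the coordinates `(s, z)` of the point `(s β, -s α, z)`, would have a critical point other
than the origin, so its discriminant would vanish. -/
theorem conic_transversal_lineForm (hD : coeffD θ ≠ 0) (hT : tangencyResultant θ ≠ 0)
    {α β γ δ : ℂ} (hq : θ .q = α * γ) (hr : θ .p - θ .n = α * δ + γ * β) (hm : -θ .m = β * δ)
    (h : α ≠ 0 ∨ β ≠ 0) (v : Fin 3 → ℂ) (hv : v ≠ 0) (hL : eval v (lineForm α β) = 0) :
    LinearIndependent ℂ ![grad (conic θ) v, grad (lineForm α β) v] := by
  obtain ⟨s, h0, h1⟩ := exists_eq_smul_of_mem_line h hL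
  rw [grad_conic, grad_lineForm]
  refine linearIndependent_of_forall_ne (fun hz => ?_) fun μ hμ => ?_
  · have e0 := congrFun hz 0
    have e1 := congrFun hz 1
    simp at e0 e1
    tauto
  have g0 := congrFun hμ 0
  have g1 := congrFun hμ 1
  have g2 := congrFun hμ 2
  simp [h0, h1] at g0 g1 g2
  set lam := coeffXZ θ * β + coeffYZ θ * (-α) with hlam
  set T := θ .a * β ^ 2 + θ .b * β * (-α) + θ .c * (-α) ^ 2 with hTdef
  have k1 : 2 * coeffD θ * T * s + lam * v 2 = 0 := by
    rw [hlam, hTdef]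
    linear_combination β * g0 - α * g1
  have k2 : lam * s + 2 * coeffD θ * v 2 = 0 := by
    rw [hlam]
    linear_combination g2
  have hs : s ≠ 0 := by
    rintro rfl
    refine vec_ne_zero hv ⟨by simp [h0], by simp [h1], ?_⟩
    simpa [hD] using k2
  have hdisc : lam ^ 2 - 4 * coeffD θ ^ 2 * T = 0 := by
    have : (lam ^ 2 - 4 * coeffD θ ^ 2 * T) * s = 0 := by
      linear_combination lam * k2 - 2 * coeffD θ * k1
    simpa [hs] using this
  have := eq_zero_of_quadResultant_ne_zero (x := β) (y := -α) hT
    (by rw [hlam, hTdef] at hdisc; linear_combination hdisc) (linePair_root hq hr hm)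
  simp at this
  tauto

theorem conic_disjoint_lineForm_infinity (hD : coeffD θ ≠ 0) (hI : infinityResultant θ ≠ 0)
    {α β γ δ : ℂ} (hq : θ .q = α * γ) (hr : θ .p - θ .n = α * δ + γ * β) (hm : -θ .m = β * δ)
    (v : Fin 3 → ℂ) (hv : v ≠ 0) (hz : v 2 = 0) :
    ¬ (eval v (conic θ) = 0 ∧ eval v (lineForm α β) = 0) := by
  rintro ⟨h1, h2⟩
  rw [eval_conic, hz] at h1
  rw [eval_lineForm] at h2
  have h1' : θ .a * v 0 ^ 2 + θ .b * v 0 * v 1 + θ .c * v 1 ^ 2 = 0 := by simpa [hD] using h1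
  have := eq_zero_of_quadResultant_ne_zero hI h1' (by
    rw [hq, hr, hm]
    linear_combination (γ * v 0 + δ * v 1) * h2)
  exact vec_ne_zero hv ⟨this.1, this.2, hz⟩

theorem exists_lines (θ : Param → ℂ) : ∃ α β γ δ : ℂ,
    θ .q = α * γ ∧ θ .p - θ .n = α * δ + γ * β ∧ -θ .m = β * δ :=
  exists_binary_factorization _ _ _

theorem det_ne_zero_of_lineDiscr_ne_zero (h : lineDiscr θ ≠ 0) {α β γ δ : ℂ}
    (hq : θ .q = α * γ) (hr : θ .p - θ .n = α * δ + γ * β) (hm : -θ .m = β * δ) :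
    α * δ - γ * β ≠ 0 := by
  intro h0
  apply h
  unfold lineDiscr
  rw [hr, hq]
  linear_combination (α * δ - γ * β) * h0 - 4 * (α * γ) * hm

theorem inGeneralPosition (hg : genericity θ ≠ 0) {α β γ δ : ℂ}
    (hq : θ .q = α * γ) (hr : θ .p - θ .n = α * δ + γ * β) (hm : -θ .m = β * δ) :
    InGeneralPosition ![conic θ, lineForm α β, lineForm γ δ] := by
  simp only [genericity, mul_ne_zero_iff] at hg
  obtain ⟨⟨⟨⟨⟨hD, hΔ⟩, hinf⟩, hc⟩, hI⟩, hT⟩ := hg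
  have hdet := det_ne_zero_of_lineDiscr_ne_zero hΔ hq hr hm
  have h1 : α ≠ 0 ∨ β ≠ 0 := by
    by_contra! h
    simp [h.1, h.2] at hdet
  have h2 : γ ≠ 0 ∨ δ ≠ 0 := by
    by_contra! h
    simp [h.1, h.2] at hdet
  have hq' : θ .q = γ * α := by rw [hq, mul_comm]
  have hr' : θ .p - θ .n = γ * β + α * δ := by rw [hr, add_comm]
  have hm' : -θ .m = δ * β := by rw [hm, mul_comm]
  refine .of_three ?_ ?_ ?_ ?_ ?_
  · simp only [Fin.forall_fin_succ, Fin.forall_fin_zero, and_true]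
    exact ⟨conic_isSmoothCurve hc, lineForm_isSmoothCurve h1, lineForm_isSmoothCurve h2⟩
  · simp only [Fin.forall_fin_succ, Fin.forall_fin_zero, and_true]
    exact ⟨fun v hv hz _ => conic_transversal_infinity hD hinf v hv hz,
      fun v _ _ _ => lineForm_transversal_infinity h1 v,
      fun v _ _ _ => lineForm_transversal_infinity h2 v⟩
  · intro i j hij v hv hi hj
    have : (i = 0 ∧ j = 1) ∨ (i = 0 ∧ j = 2) ∨ (i = 1 ∧ j = 2) := by omega
    rcases this with ⟨rfl, rfl⟩ | ⟨rfl, rfl⟩ | ⟨rfl, rfl⟩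
    · exact conic_transversal_lineForm hD hT hq hr hm h1 v hv hj
    · exact conic_transversal_lineForm hD hT hq' hr' hm' h2 v hv hj
    · exact lineForm_transversal_lineForm hdet v
  · intro i j hij v hv hz
    have : (i = 0 ∧ j = 1) ∨ (i = 0 ∧ j = 2) ∨ (i = 1 ∧ j = 2) := by omega
    rcases this with ⟨rfl, rfl⟩ | ⟨rfl, rfl⟩ | ⟨rfl, rfl⟩
    · exact conic_disjoint_lineForm_infinity hD hI hq hr hm v hv hz
    · exact conic_disjoint_lineForm_infinity hD hI hq' hr' hm' v hv hz
    · rintro ⟨e1, e2⟩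
      obtain ⟨h0, h1⟩ := eq_zero_of_mem_lines hdet e1 e2
      exact vec_ne_zero hv ⟨h0, h1, hz⟩
  · intro v hv h
    obtain ⟨h0, h1⟩ := eq_zero_of_mem_lines hdet (h 1) (h 2)
    have hF : eval v (conic θ) = 0 := h 0
    rw [eval_conic, h0, h1] at hF
    exact vec_ne_zero hv ⟨h0, h1, by simpa [hD] using hF⟩

theorem conic_ne_zero (hD : coeffD θ ≠ 0) : conic θ ≠ 0 := by
  intro h
  have := eval_conic θ ![0, 0, 1]
  rw [h] at this
  simp at this
  exact hD this.symm

theorem isIntegralCurve_conic (hD : coeffD θ ≠ 0) : IsIntegralCurve 3 (form θ) (conic θ) :=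
  ⟨conic_ne_zero hD, _, isCofactor_conic θ⟩

theorem form_mem_YDarboux (hg : genericity θ ≠ 0) : form θ ∈ YDarboux 3 ![2, 1, 1] := by
  obtain ⟨α, β, γ, δ, hq, hr, hm⟩ := exists_lines θ
  refine ⟨form_mem_V θ, _, ?_, inGeneralPosition hg hq hr hm, ?_⟩
  · simp only [Fin.forall_fin_succ, Fin.forall_fin_zero, and_true]
    exact ⟨conic_isHomogeneous θ, isHomogeneous_lineForm _ _, isHomogeneous_lineForm _ _⟩
  · simp only [genericity, mul_ne_zero_iff] at hg
    have hdet := det_ne_zero_of_lineDiscr_ne_zero hg.1.1.1.1.2 hq hr hm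
    have hdet' : γ * β - α * δ ≠ 0 := fun h => hdet (by linear_combination -h)
    simp only [Fin.forall_fin_succ, Fin.forall_fin_zero, and_true]
    exact ⟨isIntegralCurve_conic hg.1.1.1.1.1, ⟨lineForm_ne_zero hdet, _, isCofactor_line hq hr hm⟩,
      ⟨lineForm_ne_zero hdet', _, isCofactor_line (by rw [hq, mul_comm]) (by rw [hr, add_comm])
        (by rw [hm, mul_comm])⟩⟩

/-- The first part of the theorem at one parameter, under the genericity condition. -/
theorem darbouxIntegrable_of_genericity_ne_zero (hg : genericity θ ≠ 0) :
    (conic θ).IsHomogeneous 2 ∧ IsSmoothCurve (conic θ) ∧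
      IsIntegralCurve 3 (form θ) (conic θ) ∧
      ∃ L₁ L₂ : Poly, L₁.IsHomogeneous 1 ∧ L₂.IsHomogeneous 1 ∧
        LinearIndependent ℂ ![L₁, L₂] ∧ L₁ * L₂ = linePair θ ∧
        IsIntegralCurve 3 (form θ) L₁ ∧ IsIntegralCurve 3 (form θ) L₂ ∧
        IsDarbouxIntegrableWith 3 (form θ) ![conic θ, L₁, L₂] := by
  obtain ⟨α, β, γ, δ, hq, hr, hm⟩ := exists_lines θ
  simp only [genericity, mul_ne_zero_iff] at hg
  obtain ⟨⟨⟨⟨⟨hD, hΔ⟩, -⟩, hc⟩, -⟩, -⟩ := hg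
  have hdet := det_ne_zero_of_lineDiscr_ne_zero hΔ hq hr hm
  have hdet' : γ * β - α * δ ≠ 0 := fun h => hdet (by linear_combination -h)
  have hK₁ := isCofactor_line hq hr hm
  have hK₂ : IsCofactor 3 (form θ) (lineForm γ δ) (lineCofactor θ γ δ α β) :=
    isCofactor_line (by rw [hq, mul_comm]) (by rw [hr, add_comm]) (by rw [hm, mul_comm])
  have hL₁ := lineForm_ne_zero hdet
  have hL₂ := lineForm_ne_zero hdet'
  refine ⟨conic_isHomogeneous θ, conic_isSmoothCurve hc, isIntegralCurve_conic hD,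
    lineForm α β, lineForm γ δ, isHomogeneous_lineForm _ _, isHomogeneous_lineForm _ _,
    linearIndependent_lineForm hdet, linePair_eq hq hr hm, ⟨hL₁, _, hK₁⟩, ⟨hL₂, _, hK₂⟩, ?_,
    ![conicCofactor θ, lineCofactor θ α β γ δ, lineCofactor θ γ δ α β], fun _ => 1, ?_, ?_⟩
  · simp only [Fin.forall_fin_succ, Fin.forall_fin_zero, and_true]
    exact ⟨conic_ne_zero hD, hL₁, hL₂⟩
  · simp only [Fin.forall_fin_succ, Fin.forall_fin_zero, and_true]
    exact ⟨isCofactor_conic θ, hK₁, hK₂⟩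
  · rw [pderiv_sub_eq_sum_cofactors hq hr hm]
    simp [Fin.sum_univ_three]

end CR16
end PoincareCenter

namespace PoincareCenter

/-! ### Affine changes of coordinates -/

/-- The chain rule for polynomial substitutions. -/
theorem pderiv_aeval {σ τ R : Type*} [Fintype σ] [CommRing R] (g : σ → MvPolynomial τ R)
    (F : MvPolynomial σ R) (i : τ) :
    pderiv i (aeval g F) = ∑ j, aeval g (pderiv j F) * pderiv i (g j) := by
  classical
  induction F using MvPolynomial.induction_on with
  | C a => simp
  | add p q hp hq => simp only [map_add, hp, hq, Finset.sum_add_distrib, add_mul]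
  | mul_X p k hp =>
    simp only [map_mul, aeval_X, Derivation.leibniz, smul_eq_mul, hp, map_add, pderiv_X, add_mul,
      Finset.sum_add_distrib, Finset.mul_sum]
    congr 1
    · simp [Pi.single_apply, mul_ite, ite_mul]
    · exact Finset.sum_congr rfl fun _ _ => by ring

variable (A : Matrix (Fin 2) (Fin 2) ℂ) (t : Fin 2 → ℂ)

/-- The affine map `(x, y) ↦ (A₀₀ x + A₀₁ y + t₀, A₁₀ x + A₁₁ y + t₁)` in homogeneous
coordinates, as a substitution. -/
noncomputable def affineSubst : Fin 3 → Poly :=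
  ![C (A 0 0) * X 0 + C (A 0 1) * X 1 + C (t 0) * X 2,
    C (A 1 0) * X 0 + C (A 1 1) * X 1 + C (t 1) * X 2,
    X 2]

/-- The same affine map on points. -/
def affineMap (v : Fin 3 → ℂ) : Fin 3 → ℂ :=
  ![A 0 0 * v 0 + A 0 1 * v 1 + t 0 * v 2, A 1 0 * v 0 + A 1 1 * v 1 + t 1 * v 2, v 2]

theorem affinePullback_eq (ω : Form) : affinePullback A t ω =
    (C (A 0 0) * aeval (affineSubst A t) ω.1 + C (A 1 0) * aeval (affineSubst A t) ω.2,
      C (A 0 1) * aeval (affineSubst A t) ω.1 + C (A 1 1) * aeval (affineSubst A t) ω.2) :=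
  rfl

theorem eval_aeval_affineSubst (F : Poly) (v : Fin 3 → ℂ) :
    eval v (aeval (affineSubst A t) F) = eval (affineMap A t v) F := by
  rw [← MvPolynomial.coe_aeval_eq_eval, ← MvPolynomial.coe_aeval_eq_eval]
  change (aeval v).comp (aeval (affineSubst A t)) F = aeval (affineMap A t v) F
  congr 1
  ext i
  fin_cases i <;> simp [affineSubst, affineMap]

theorem aeval_affineSubst_comp (A' : Matrix (Fin 2) (Fin 2) ℂ) (t' : Fin 2 → ℂ) (F : Poly) :
    aeval (affineSubst A' t') (aeval (affineSubst A t) F) =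
      aeval (affineSubst (A * A') (A.mulVec t' + t)) F := by
  have h : (aeval (affineSubst A' t')).comp (aeval (affineSubst A t)) =
      (aeval (affineSubst (A * A') (A.mulVec t' + t)) : Poly →ₐ[ℂ] Poly) := by
    ext1 i
    fin_cases i
    · simp [affineSubst, Matrix.mul_apply, Fin.sum_univ_two]
      ring
    · simp [affineSubst, Matrix.mul_apply, Fin.sum_univ_two]
      ring
    · simp [affineSubst]
  exact DFunLike.congr_fun h F

theorem affinePullback_comp (A' : Matrix (Fin 2) (Fin 2) ℂ) (t' : Fin 2 → ℂ) (ω : Form) :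
    affinePullback A' t' (affinePullback A t ω) =
      affinePullback (A * A') (A.mulVec t' + t) ω := by
  have h1 := aeval_affineSubst_comp A t A' t' ω.1
  have h2 := aeval_affineSubst_comp A t A' t' ω.2
  refine Prod.ext ?_ ?_
  all_goals
    simp only [affinePullback_eq, map_add, map_mul, aeval_C, algebraMap_eq, h1, h2,
      Matrix.mul_apply, Fin.sum_univ_two]
    ring

theorem pderiv_zero_aeval_affineSubst (F : Poly) : pderiv 0 (aeval (affineSubst A t) F) =
    C (A 0 0) * aeval (affineSubst A t) (pderiv 0 F)
      + C (A 1 0) * aeval (affineSubst A t) (pderiv 1 F) := by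
  rw [pderiv_aeval, Fin.sum_univ_three]
  simp [affineSubst]
  ring

theorem pderiv_one_aeval_affineSubst (F : Poly) : pderiv 1 (aeval (affineSubst A t) F) =
    C (A 0 1) * aeval (affineSubst A t) (pderiv 0 F)
      + C (A 1 1) * aeval (affineSubst A t) (pderiv 1 F) := by
  rw [pderiv_aeval, Fin.sum_univ_three]
  simp [affineSubst]
  ring

theorem pderiv_two_aeval_affineSubst (F : Poly) : pderiv 2 (aeval (affineSubst A t) F) =
    C (t 0) * aeval (affineSubst A t) (pderiv 0 F)
      + C (t 1) * aeval (affineSubst A t) (pderiv 1 F)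
      + aeval (affineSubst A t) (pderiv 2 F) := by
  rw [pderiv_aeval, Fin.sum_univ_three]
  simp [affineSubst]
  ring

theorem isHomogeneous_aeval_affineSubst {F : Poly} {d : ℕ} (hF : F.IsHomogeneous d) :
    (aeval (affineSubst A t) F).IsHomogeneous d := by
  have h : ∀ i, (affineSubst A t i).IsHomogeneous 1 := by
    simp only [Fin.forall_fin_succ, Fin.forall_fin_zero, and_true]
    have hX (r : ℂ) (i : Fin 3) : (C r * X i : Poly).IsHomogeneous 1 := isHomogeneous_C_mul_X r i
    exact ⟨((hX _ _).add (hX _ _)).add (hX _ _), ((hX _ _).add (hX _ _)).add (hX _ _),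
      isHomogeneous_X _ _⟩
  simpa using hF.aeval _ h

theorem affinePullback_mem_V {ω : Form} {d : ℕ} (h : ω ∈ V d) : affinePullback A t ω ∈ V d :=
  ⟨((isHomogeneous_aeval_affineSubst A t h.1).C_mul _).add
      ((isHomogeneous_aeval_affineSubst A t h.2).C_mul _),
    ((isHomogeneous_aeval_affineSubst A t h.1).C_mul _).add
      ((isHomogeneous_aeval_affineSubst A t h.2).C_mul _)⟩

/-- The transpose of the linear part of `affineMap A t`, acting on gradients. -/
def affineGrad (w : Fin 3 → ℂ) : Fin 3 → ℂ :=
  ![A 0 0 * w 0 + A 1 0 * w 1, A 0 1 * w 0 + A 1 1 * w 1, t 0 * w 0 + t 1 * w 1 + w 2]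

theorem grad_aeval_affineSubst (F : Poly) (v : Fin 3 → ℂ) :
    grad (aeval (affineSubst A t) F) v = affineGrad A t (grad F (affineMap A t v)) := by
  funext i
  fin_cases i
  · simp only [Fin.zero_eta, grad, pderiv_zero_aeval_affineSubst, map_add, map_mul, eval_C,
      eval_aeval_affineSubst]
    rfl
  · simp only [Fin.mk_one, grad, pderiv_one_aeval_affineSubst, map_add, map_mul, eval_C,
      eval_aeval_affineSubst]
    rfl
  · simp only [Fin.reduceFinMk, grad, pderiv_two_aeval_affineSubst, map_add, map_mul, eval_C,
      eval_aeval_affineSubst]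
    rfl

variable {A}

theorem affineGrad_eq_zero (hA : A.det ≠ 0) {w : Fin 3 → ℂ} (h : affineGrad A t w = 0) :
    w = 0 := by
  rw [Matrix.det_fin_two] at hA
  have h0 := congrFun h 0
  have h1 := congrFun h 1
  have h2 := congrFun h 2
  simp [affineGrad] at h0 h1 h2
  have e0 : w 0 * (A 0 0 * A 1 1 - A 0 1 * A 1 0) = 0 := by
    linear_combination A 1 1 * h0 - A 1 0 * h1
  have e1 : w 1 * (A 0 0 * A 1 1 - A 0 1 * A 1 0) = 0 := by
    linear_combination A 0 0 * h1 - A 0 1 * h0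
  have e0' := (mul_eq_zero.1 e0).resolve_right hA
  have e1' := (mul_eq_zero.1 e1).resolve_right hA
  rw [e0', e1'] at h2
  funext i
  fin_cases i
  exacts [e0', e1', by simpa using h2]

theorem affineMap_ne_zero (hA : A.det ≠ 0) {v : Fin 3 → ℂ} (hv : v ≠ 0) :
    affineMap A t v ≠ 0 := by
  rw [Matrix.det_fin_two] at hA
  intro h
  have h0 := congrFun h 0
  have h1 := congrFun h 1
  have h2 := congrFun h 2
  simp [affineMap] at h0 h1 h2
  simp only [h2, mul_zero, add_zero] at h0 h1
  have e0 : v 0 * (A 0 0 * A 1 1 - A 0 1 * A 1 0) = 0 := by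
    linear_combination A 1 1 * h0 - A 0 1 * h1
  have e1 : v 1 * (A 0 0 * A 1 1 - A 0 1 * A 1 0) = 0 := by
    linear_combination A 0 0 * h1 - A 1 0 * h0
  exact vec_ne_zero hv
    ⟨(mul_eq_zero.1 e0).resolve_right hA, (mul_eq_zero.1 e1).resolve_right hA, h2⟩

theorem linearIndependent_affineGrad (hA : A.det ≠ 0) {u w : Fin 3 → ℂ}
    (h : LinearIndependent ℂ ![u, w]) :
    LinearIndependent ℂ ![affineGrad A t u, affineGrad A t w] := by
  rw [LinearIndependent.pair_iff] at h ⊢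
  intro a b hab
  refine h a b (affineGrad_eq_zero t hA ?_)
  rw [← hab]
  funext i
  fin_cases i <;> simp [affineGrad] <;> ring

theorem InGeneralPosition.affine (hA : A.det ≠ 0) {r : ℕ} {F : Fin r → Poly}
    (h : InGeneralPosition F) :
    InGeneralPosition fun i => aeval (affineSubst A t) (F i) where
  smooth i v hv h0 hg := by
    rw [eval_aeval_affineSubst] at h0
    rw [grad_aeval_affineSubst] at hg
    exact h.smooth i _ (affineMap_ne_zero t hA hv) h0 (affineGrad_eq_zero t hA hg)
  transversal_infinity i v hv hz h0 := by
    rw [eval_aeval_affineSubst] at h0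
    have hX : grad (X 2) v = affineGrad A t (grad (X 2) (affineMap A t v)) := by
      rw [← grad_aeval_affineSubst]
      simp [affineSubst]
    rw [grad_aeval_affineSubst, hX]
    exact linearIndependent_affineGrad t hA
      (h.transversal_infinity i _ (affineMap_ne_zero t hA hv) hz h0)
  transversal i j hij v hv hi hj := by
    rw [eval_aeval_affineSubst] at hi hj
    rw [grad_aeval_affineSubst, grad_aeval_affineSubst]
    exact linearIndependent_affineGrad t hA
      (h.transversal i j hij _ (affineMap_ne_zero t hA hv) hi hj)
  disjoint_infinity i j hij v hv hz := by
    rw [eval_aeval_affineSubst, eval_aeval_affineSubst]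
    exact h.disjoint_infinity i j hij _ (affineMap_ne_zero t hA hv) hz
  no_triple_point i j k hij hik hjk v hv := by
    rw [eval_aeval_affineSubst, eval_aeval_affineSubst, eval_aeval_affineSubst]
    exact h.no_triple_point i j k hij hik hjk _ (affineMap_ne_zero t hA hv)

theorem aeval_affineSubst_ne_zero (hA : A.det ≠ 0) {F : Poly} (hF : F ≠ 0) :
    aeval (affineSubst A t) F ≠ 0 := by
  intro h
  have hu : IsUnit A.det := isUnit_iff_ne_zero.2 hA
  have h' := aeval_affineSubst_comp A t A⁻¹ (A⁻¹.mulVec (-t)) F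
  rw [h, map_zero, Matrix.mul_nonsing_inv A hu, Matrix.mulVec_mulVec, Matrix.mul_nonsing_inv A hu,
    Matrix.one_mulVec, neg_add_cancel] at h'
  have hid : affineSubst 1 0 = X := by
    funext i
    fin_cases i <;> simp [affineSubst]
  rw [hid, aeval_X_left_apply] at h'
  exact hF h'.symm

theorem IsIntegralCurve.affine (hA : A.det ≠ 0) {d : ℕ} {ω : Form} {F : Poly}
    (h : IsIntegralCurve d ω F) :
    IsIntegralCurve d (affinePullback A t ω) (aeval (affineSubst A t) F) := by
  obtain ⟨hF, K, hK, hc⟩ := h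
  refine ⟨aeval_affineSubst_ne_zero t hA hF, C A.det * aeval (affineSubst A t) K,
    (isHomogeneous_aeval_affineSubst A t hK).C_mul _, ?_⟩
  have hc' := congrArg (aeval (affineSubst A t)) hc
  simp only [map_sub, map_mul, map_neg] at hc'
  rw [affinePullback_eq, pderiv_zero_aeval_affineSubst, pderiv_one_aeval_affineSubst,
    Matrix.det_fin_two]
  simp only [map_sub, map_mul]
  linear_combination (C (A 0 0) * C (A 1 1) - C (A 0 1) * C (A 1 0)) * hc'

theorem affinePullback_mem_YDarboux (hA : A.det ≠ 0) {d r : ℕ} {deg : Fin r → ℕ} {ω : Form}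
    (h : ω ∈ YDarboux d deg) : affinePullback A t ω ∈ YDarboux d deg := by
  obtain ⟨hV, F, hF, hG, hI⟩ := h
  exact ⟨affinePullback_mem_V A t hV, _, fun i => isHomogeneous_aeval_affineSubst A t (hF i),
    hG.affine t hA, fun i => (hI i).affine t hA⟩

/-! ### Linear parts and Poincaré forms -/

/-- The Jacobian matrix `(P_x, P_y; Q_x, Q_y)` of a form at the affine point `t`. -/
noncomputable def jacobian (ω : Form) (t : Fin 2 → ℂ) : Matrix (Fin 2) (Fin 2) ℂ :=
  !![eval ![t 0, t 1, 1] (pderiv 0 ω.1), eval ![t 0, t 1, 1] (pderiv 1 ω.1);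
    eval ![t 0, t 1, 1] (pderiv 0 ω.2), eval ![t 0, t 1, 1] (pderiv 1 ω.2)]

theorem affineMap_origin : affineMap A t origin = ![t 0, t 1, 1] := by
  simp [affineMap, origin]

theorem origin_eq : origin = ![(0 : Fin 2 → ℂ) 0, (0 : Fin 2 → ℂ) 1, 1] := rfl

/-- The linear part of a form transforms like a bilinear form. -/
theorem jacobian_affinePullback (ω : Form) :
    jacobian (affinePullback A t ω) 0 = A.transpose * jacobian ω t * A := by
  ext i j
  fin_cases i <;> fin_cases j <;>
    simp only [Fin.zero_eta, Fin.mk_one, jacobian, ← origin_eq, affinePullback_eq,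
      Matrix.mul_apply, Fin.sum_univ_two, Matrix.transpose_apply, Matrix.of_apply,
      Matrix.cons_val_zero, Matrix.cons_val_one, Matrix.cons_val', Matrix.cons_val_fin_one,
      map_add, map_mul, pderiv_C_mul, pderiv_zero_aeval_affineSubst,
      pderiv_one_aeval_affineSubst, eval_C, eval_aeval_affineSubst, affineMap_origin] <;> ring

theorem mem_poincareForms_iff {d : ℕ} {ω : Form} : ω ∈ poincareForms d ↔
    ω ∈ V d ∧ eval origin ω.1 = 0 ∧ eval origin ω.2 = 0 ∧ jacobian ω 0 = 1 := by
  have h : jacobian ω 0 = !![eval origin (pderiv 0 ω.1), eval origin (pderiv 1 ω.1);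
      eval origin (pderiv 0 ω.2), eval origin (pderiv 1 ω.2)] := rfl
  constructor
  · rintro ⟨hV, h1, h2, h3, h4, h5, h6⟩
    exact ⟨hV, h1, h2, by rw [h, h3, h4, h5, h6, Matrix.one_fin_two]⟩
  · rintro ⟨hV, h1, h2, h3⟩
    rw [h] at h3
    exact ⟨hV, h1, h2, congrFun (congrFun h3 0) 0, congrFun (congrFun h3 1) 1,
      congrFun (congrFun h3 0) 1, congrFun (congrFun h3 1) 0⟩

/-- The pullback of `ω` by an affine map that sends the origin to `t` is a Poincaré form exactly
when `ω` vanishes at `t` and the linear part at `t` becomes the identity. -/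
theorem affinePullback_mem_poincareForms (hA : A.det ≠ 0) {d : ℕ} {ω : Form} (hω : ω ∈ V d) :
    affinePullback A t ω ∈ poincareForms d ↔
      eval ![t 0, t 1, 1] ω.1 = 0 ∧ eval ![t 0, t 1, 1] ω.2 = 0 ∧
        A.transpose * jacobian ω t * A = 1 := by
  rw [mem_poincareForms_iff, jacobian_affinePullback]
  rw [and_iff_right (affinePullback_mem_V A t hω), ← and_assoc, ← and_assoc]
  simp only [affinePullback_eq, map_add, map_mul, eval_C, eval_aeval_affineSubst, affineMap_origin]
  refine and_congr_left fun _ => ⟨fun ⟨h1, h2⟩ => ?_, fun ⟨h1, h2⟩ => by simp [h1, h2]⟩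
  rw [Matrix.det_fin_two] at hA
  set p := eval ![t 0, t 1, 1] ω.1
  set q := eval ![t 0, t 1, 1] ω.2
  have e0 : p * (A 0 0 * A 1 1 - A 0 1 * A 1 0) = 0 := by
    linear_combination A 1 1 * h1 - A 1 0 * h2
  have e1 : q * (A 0 0 * A 1 1 - A 0 1 * A 1 0) = 0 := by
    linear_combination A 0 0 * h2 - A 0 1 * h1
  exact ⟨(mul_eq_zero.1 e0).resolve_right hA, (mul_eq_zero.1 e1).resolve_right hA⟩

end PoincareCenter

namespace PoincareCenter

open Filter Topology

/-! ### Normalization of the position of the origin -/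

namespace CR16

/-- The action of the linear substitution with matrix `G` on the parameters. It transforms `T₂` and
the linear form `k y + l x` by substitution (the latter with a factor `det G`), and the matrix
`M = (q, -n; p, -m)` of the bilinear form `(q x + p y) dx - (n x + m y) dy` into `Gᵀ M G`. -/
def linearAction (G : Matrix (Fin 2) (Fin 2) ℂ) (θ : Param → ℂ) : Param → ℂ
  | .a => θ .a * G 0 0 ^ 2 + θ .b * G 0 0 * G 1 0 + θ .c * G 1 0 ^ 2
  | .b => 2 * θ .a * G 0 0 * G 0 1 + θ .b * (G 0 0 * G 1 1 + G 0 1 * G 1 0)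
      + 2 * θ .c * G 1 0 * G 1 1
  | .c => θ .a * G 0 1 ^ 2 + θ .b * G 0 1 * G 1 1 + θ .c * G 1 1 ^ 2
  | .d => θ .d * G 0 0 + θ .e * G 1 0
  | .e => θ .d * G 0 1 + θ .e * G 1 1
  | .k => (G 0 0 * G 1 1 - G 0 1 * G 1 0) * (θ .k * G 1 1 + θ .l * G 0 1)
  | .l => (G 0 0 * G 1 1 - G 0 1 * G 1 0) * (θ .k * G 1 0 + θ .l * G 0 0)
  | .m => θ .m * G 1 1 ^ 2 + θ .n * G 0 1 * G 1 1 - θ .p * G 0 1 * G 1 1 - θ .q * G 0 1 ^ 2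
  | .n => θ .m * G 1 0 * G 1 1 + θ .n * G 0 0 * G 1 1 - θ .p * G 0 1 * G 1 0
      - θ .q * G 0 0 * G 0 1
  | .p => θ .q * G 0 0 * G 0 1 + θ .p * G 0 0 * G 1 1 - θ .n * G 0 1 * G 1 0
      - θ .m * G 1 0 * G 1 1
  | .q => θ .q * G 0 0 ^ 2 + θ .p * G 0 0 * G 1 0 - θ .n * G 0 0 * G 1 0 - θ .m * G 1 0 ^ 2

theorem affinePullback_form_linear (G : Matrix (Fin 2) (Fin 2) ℂ) (θ : Param → ℂ) :
    affinePullback G 0 (form θ) = form (linearAction G θ) := by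
  rw [affinePullback_eq]
  refine Prod.ext ?_ ?_
  all_goals
    simp only [form, T₂, linearAction, map_add, map_sub, map_mul, map_neg, map_pow, map_ofNat,
      aeval_X, aeval_C, algebraMap_eq, affineSubst, Matrix.cons_val_zero, Matrix.cons_val_one,
      Matrix.cons_val, Pi.zero_apply, map_zero, zero_mul, add_zero]
    ring

/-- Any form of the family is given by a normal form in which the point that the affine map sends
the origin to is `(0, 0)` or `(1, 0)`: the normal forms are stable under linear substitutions. -/
theorem exists_normalized (θ : Param → ℂ) {A : Matrix (Fin 2) (Fin 2) ℂ} (hA : A.det ≠ 0)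
    (t : Fin 2 → ℂ) : t = 0 ∨ ∃ (θ' : Param → ℂ) (A' : Matrix (Fin 2) (Fin 2) ℂ), A'.det ≠ 0 ∧
      affinePullback A t (form θ) = affinePullback A' ![1, 0] (form θ') := by
  refine or_iff_not_imp_left.2 fun ht => ?_
  obtain ⟨G, hG, hGt⟩ : ∃ G : Matrix (Fin 2) (Fin 2) ℂ, G.det ≠ 0 ∧ G.mulVec ![1, 0] = t := by
    by_cases h0 : t 0 = 0
    · have h1 : t 1 ≠ 0 := fun h1 => ht (funext fun i => by fin_cases i <;> assumption)
      refine ⟨!![0, 1; t 1, 0], by simpa [Matrix.det_fin_two] using h1, ?_⟩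
      funext i
      fin_cases i <;> simp [Matrix.mulVec, h0]
    · refine ⟨!![t 0, 0; t 1, 1], by simpa [Matrix.det_fin_two] using h0, ?_⟩
      funext i
      fin_cases i <;> simp [Matrix.mulVec]
  have hu : IsUnit G.det := isUnit_iff_ne_zero.2 hG
  refine ⟨linearAction G θ, G⁻¹ * A, ?_, ?_⟩
  · rw [Matrix.det_mul]
    exact mul_ne_zero (Matrix.isUnit_nonsing_inv_det G hu).ne_zero hA
  · rw [← affinePullback_form_linear, affinePullback_comp, ← Matrix.mul_assoc,
      Matrix.mul_nonsing_inv G hu, Matrix.one_mul, hGt, add_zero]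

/-- At the common point of the two lines, the form always vanishes and its linear part is symmetric
when `p + n = 0`. -/
theorem form_at_zero (θ : Param → ℂ) :
    eval ![(0 : Fin 2 → ℂ) 0, (0 : Fin 2 → ℂ) 1, 1] (form θ).1 = 0 ∧
    eval ![(0 : Fin 2 → ℂ) 0, (0 : Fin 2 → ℂ) 1, 1] (form θ).2 = 0 ∧
    jacobian (form θ) 0 0 1 - jacobian (form θ) 0 1 0 = θ .p + θ .n := by
  refine ⟨by simp [form], by simp [form], ?_⟩
  simp [jacobian, form, T₂, pderiv_two]

/-- The values at the point `(1, 0)`. The form vanishes there when `q (1 - a) = 0` and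
`l = -n (1 + a + d) - q (b + e)`, and then its linear part is symmetric when
`(2 n - p) (1 - a) = 0`. So there are two components: `a = 1`, and `q = 0`, `p = 2 n`. -/
theorem form_at_one (θ : Param → ℂ) :
    eval ![(![1, 0] : Fin 2 → ℂ) 0, (![1, 0] : Fin 2 → ℂ) 1, 1] (form θ).1 =
      θ .q * (1 - θ .a) ∧
    eval ![(![1, 0] : Fin 2 → ℂ) 0, (![1, 0] : Fin 2 → ℂ) 1, 1] (form θ).2 =
      -(θ .l + θ .n * (1 + θ .a + θ .d) + θ .q * (θ .b + θ .e)) ∧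
    jacobian (form θ) ![1, 0] 0 1 - jacobian (form θ) ![1, 0] 1 0 =
      -(2 * θ .n - θ .p) * (1 - θ .a)
        + 3 * (θ .l + θ .n * (1 + θ .a + θ .d) + θ .q * (θ .b + θ .e)) := by
  refine ⟨?_, ?_, ?_⟩
  · simp [form, T₂]
    ring
  · simp [form, T₂]
    ring
  · simp [jacobian, form, T₂, pderiv_two]
    ring

end CR16

/-! ### Continuity of the coefficients of a form -/

/-- A one-parameter family of polynomials all of whose coefficients are continuous at `x`. -/
def CoeffContinuousAt (F : ℂ → Poly) (x : ℂ) : Prop :=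
  ∀ s, ContinuousAt (fun ε => coeff s (F ε)) x

namespace CoeffContinuousAt

variable {F G : ℂ → Poly} {x : ℂ}

theorem const (F : Poly) : CoeffContinuousAt (fun _ => F) x := fun _ => continuousAt_const

theorem C {f : ℂ → ℂ} (hf : ContinuousAt f x) : CoeffContinuousAt (fun ε => C (f ε)) x := by
  intro s
  simp only [coeff_C]
  split_ifs
  exacts [hf, continuousAt_const]

theorem add (hF : CoeffContinuousAt F x) (hG : CoeffContinuousAt G x) :
    CoeffContinuousAt (fun ε => F ε + G ε) x := by
  intro s
  simp only [coeff_add]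
  exact (hF s).add (hG s)

theorem neg (hF : CoeffContinuousAt F x) : CoeffContinuousAt (fun ε => -F ε) x := by
  intro s
  simp only [coeff_neg]
  exact (hF s).neg

theorem sub (hF : CoeffContinuousAt F x) (hG : CoeffContinuousAt G x) :
    CoeffContinuousAt (fun ε => F ε - G ε) x := by
  intro s
  simp only [coeff_sub]
  exact (hF s).sub (hG s)

theorem mul (hF : CoeffContinuousAt F x) (hG : CoeffContinuousAt G x) :
    CoeffContinuousAt (fun ε => F ε * G ε) x := by
  intro s
  simp only [coeff_mul]
  exact tendsto_finsetSum _ fun i _ => (hF i.1).mul (hG i.2)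

theorem pow (hF : CoeffContinuousAt F x) (n : ℕ) : CoeffContinuousAt (fun ε => F ε ^ n) x := by
  induction n with
  | zero => simpa using const 1
  | succ n ih => simpa only [pow_succ] using ih.mul hF

end CoeffContinuousAt

theorem coeffContinuousAt_aeval_form {g : ℂ → Fin 3 → Poly} {θ : ℂ → Param → ℂ} {x : ℂ}
    (hg : ∀ i, CoeffContinuousAt (fun ε => g ε i) x) (hθ : ∀ i, ContinuousAt (fun ε => θ ε i) x) :
    CoeffContinuousAt (fun ε => aeval (g ε) (CR16.form (θ ε)).1) x ∧
      CoeffContinuousAt (fun ε => aeval (g ε) (CR16.form (θ ε)).2) x := by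
  have hC (i : Param) : CoeffContinuousAt (fun ε => C (θ ε i)) x := .C (hθ i)
  simp only [CR16.form, CR16.T₂, map_add, map_sub, map_mul, map_neg, map_pow, map_ofNat, aeval_X,
    aeval_C, algebraMap_eq]
  constructor <;>
    repeat' with_reducible first
      | exact hC _
      | exact hg _
      | exact .const 2
      | apply CoeffContinuousAt.add
      | apply CoeffContinuousAt.sub
      | apply CoeffContinuousAt.neg
      | apply CoeffContinuousAt.mul
      | apply CoeffContinuousAt.pow

theorem continuousAt_coords_affinePullback {A : ℂ → Matrix (Fin 2) (Fin 2) ℂ} (t : Fin 2 → ℂ)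
    {θ : ℂ → Param → ℂ} {x : ℂ} (hA : ∀ i j, ContinuousAt (fun ε => A ε i j) x)
    (hθ : ∀ i, ContinuousAt (fun ε => θ ε i) x) :
    ContinuousAt (fun ε => coords (affinePullback (A ε) t (CR16.form (θ ε)))) x := by
  have hC (i j) : CoeffContinuousAt (fun ε => C (A ε i j)) x := .C (hA i j)
  have hg : ∀ i, CoeffContinuousAt (fun ε => affineSubst (A ε) t i) x := by
    simp only [Fin.forall_fin_succ, Fin.forall_fin_zero, and_true]
    exact ⟨(((hC _ _).mul (.const _)).add ((hC _ _).mul (.const _))).add (.const _),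
      (((hC _ _).mul (.const _)).add ((hC _ _).mul (.const _))).add (.const _), .const _⟩
  obtain ⟨h1, h2⟩ := coeffContinuousAt_aeval_form hg hθ
  refine continuousAt_pi.2 fun s => ?_
  rcases s with s | s
  · exact ((hC 0 0).mul h1).add ((hC 1 0).mul h2) s
  · exact ((hC 0 1).mul h1).add ((hC 1 1).mul h2) s

theorem continuous_jacobian_form {θ : ℂ → Param → ℂ} (hθ : Continuous θ) (t : Fin 2 → ℂ) :
    Continuous fun ε => jacobian (CR16.form (θ ε)) t := by
  refine continuous_matrix fun i j => ?_
  fin_cases i <;> fin_cases j <;> simp [jacobian, CR16.form, CR16.T₂, pderiv_two] <;> fun_prop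

/-! ### Degeneration along a path of parameters -/

/-- An upper triangular matrix `U` with `Uᵀ S U = 1`, for a symmetric matrix `S` with nonzero
leading principal minors; it is given by the Gram–Schmidt process, with the principal branch of the square
root. -/
noncomputable def gramSchmidt (S : Matrix (Fin 2) (Fin 2) ℂ) : Matrix (Fin 2) (Fin 2) ℂ :=
  !![(S 0 0 ^ ((2 : ℕ)⁻¹ : ℂ))⁻¹,
      -(S 0 1 / S 0 0) * ((S 1 1 - S 0 1 ^ 2 / S 0 0) ^ ((2 : ℕ)⁻¹ : ℂ))⁻¹;
    0, ((S 1 1 - S 0 1 ^ 2 / S 0 0) ^ ((2 : ℕ)⁻¹ : ℂ))⁻¹]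

theorem gramSchmidt_one : gramSchmidt 1 = 1 := by
  simp [gramSchmidt, Matrix.one_fin_two]

theorem gramSchmidt_spec {S : Matrix (Fin 2) (Fin 2) ℂ} (hS : S 0 1 = S 1 0) (h0 : S 0 0 ≠ 0)
    (h1 : S 1 1 - S 0 1 ^ 2 / S 0 0 ≠ 0) :
    (gramSchmidt S).det ≠ 0 ∧ (gramSchmidt S).transpose * S * gramSchmidt S = 1 := by
  have e0 := Complex.cpow_nat_inv_pow (S 0 0) two_ne_zero
  have e1 := Complex.cpow_nat_inv_pow (S 1 1 - S 0 1 ^ 2 / S 0 0) two_ne_zero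
  unfold gramSchmidt
  set u := S 0 0 ^ ((2 : ℕ)⁻¹ : ℂ)
  set w := (S 1 1 - S 0 1 ^ 2 / S 0 0) ^ ((2 : ℕ)⁻¹ : ℂ)
  have hu : u ≠ 0 := fun h => h0 (by rw [← e0, h]; simp)
  have hw : w ≠ 0 := fun h => h1 (by rw [← e1, h]; simp)
  have e1' : w ^ 2 * S 0 0 = S 1 1 * S 0 0 - S 0 1 ^ 2 := by
    rw [e1]
    field_simp
  refine ⟨by simp [Matrix.det_fin_two, hu, hw], ?_⟩
  ext i j
  fin_cases i <;> fin_cases j <;>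
    simp [Matrix.mul_apply, Fin.sum_univ_two, ← hS]
  · field_simp
    exact e0.symm
  · field_simp
    ring
  · field_simp
    simp
  · field_simp
    linear_combination -e1'

theorem continuousAt_gramSchmidt {S : ℂ → Matrix (Fin 2) (Fin 2) ℂ} {x : ℂ}
    (hS : ContinuousAt S x) (hx : S x = 1) (i j : Fin 2) :
    ContinuousAt (fun ε => gramSchmidt (S ε) i j) x := by
  have h (i j) : ContinuousAt (fun ε => S ε i j) x :=
    (continuousAt_pi.1 (continuousAt_pi.1 hS i) j)
  have h00 : S x 0 0 ≠ 0 := by simp [hx]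
  have hw : ContinuousAt (fun ε => S ε 1 1 - S ε 0 1 ^ 2 / S ε 0 0) x :=
    (h 1 1).sub (((h 0 1).pow 2).div (h 0 0) h00)
  have h1 : ContinuousAt (fun ε => (S ε 0 0 ^ ((2 : ℕ)⁻¹ : ℂ))⁻¹) x :=
    ((h 0 0).cpow continuousAt_const (by simp [hx])).inv₀ (by simp [hx])
  have h2 : ContinuousAt
      (fun ε => ((S ε 1 1 - S ε 0 1 ^ 2 / S ε 0 0) ^ ((2 : ℕ)⁻¹ : ℂ))⁻¹) x :=
    (hw.cpow continuousAt_const (by simp [hx])).inv₀ (by simp [hx])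
  fin_cases i <;> fin_cases j
  · exact h1
  · exact (((h 0 1).div (h 0 0) h00).neg).mul h2
  · exact continuousAt_const
  · exact h2

/-- Along a polynomial path of parameters on which the form keeps vanishing at `t` with symmetric
linear part, the Gram–Schmidt process turns the pullbacks into Poincaré forms. If the path has a
generic point, then all but finitely many of its points are generic, and the start of the path is a
limit of forms with curves in general position. -/
theorem mem_zariskiClosure_of_path {A : Matrix (Fin 2) (Fin 2) ℂ} (hA : A.det ≠ 0)
    (t : Fin 2 → ℂ) (θ : Param → Polynomial ℂ)
    (h0 : affinePullback A t (CR16.form fun i => (θ i).eval 0) ∈ poincareForms 3)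
    (hP : ∀ ε, eval ![t 0, t 1, 1] (CR16.form fun i => (θ i).eval ε).1 = 0)
    (hQ : ∀ ε, eval ![t 0, t 1, 1] (CR16.form fun i => (θ i).eval ε).2 = 0)
    (hJ : ∀ ε, jacobian (CR16.form fun i => (θ i).eval ε) t 0 1 =
      jacobian (CR16.form fun i => (θ i).eval ε) t 1 0)
    (hg : CR16.genericity (fun i => (θ i).eval 1) ≠ 0) :
    affinePullback A t (CR16.form fun i => (θ i).eval 0) ∈
      zariskiClosure 3 (XDarboux 3 ![2, 1, 1]) := by
  refine ⟨h0, fun f hf => ?_⟩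
  have hθ : Continuous fun ε : ℂ => fun i => (θ i).eval ε :=
    continuous_pi fun i => (θ i).continuous
  set S : ℂ → Matrix (Fin 2) (Fin 2) ℂ := fun ε =>
    A.transpose * jacobian (CR16.form fun i => (θ i).eval ε) t * A with hSdef
  have hS : Continuous S :=
    (continuous_const.matrix_mul (continuous_jacobian_form hθ t)).matrix_mul continuous_const
  have hS0 : S 0 = 1 :=
    ((affinePullback_mem_poincareForms t hA (CR16.form_mem_V _)).1 h0).2.2
  have hSsymm (ε : ℂ) : S ε 0 1 = S ε 1 0 := by
    simp only [hSdef, Matrix.mul_apply, Fin.sum_univ_two, Matrix.transpose_apply, hJ ε]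
    ring
  have hSc (i j) : ContinuousAt (fun ε => S ε i j) 0 :=
    (hS.matrix_elem i j).continuousAt
  -- At time `0` the correction is the identity, since the pullback is already a Poincaré form.
  have hcont : ContinuousAt (fun ε => eval (coords (affinePullback (A * gramSchmidt (S ε)) t
      (CR16.form fun i => (θ i).eval ε))) f) 0 := by
    refine (MvPolynomial.continuous_eval f).continuousAt.comp
      (continuousAt_coords_affinePullback t (fun i j => ?_) fun i => (θ i).continuous.continuousAt)
    simp only [Matrix.mul_apply]
    exact tendsto_finsetSum _ fun k _ =>
      continuousAt_const.mul (continuousAt_gramSchmidt hS.continuousAt hS0 k j)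
  have hgen : ∀ᶠ ε in 𝓝[≠] (0 : ℂ), CR16.genericity (fun i => (θ i).eval ε) ≠ 0 := by
    -- The genericity along the path is a polynomial in `ε` that is nonzero at `ε = 1`.
    have hev (ε : ℂ) : CR16.genericity (fun i => (θ i).eval ε) = (CR16.genericity θ).eval ε :=
      (CR16.map_genericity θ (Polynomial.evalRingHom ε)).symm
    have hne : CR16.genericity θ ≠ 0 := by
      intro h
      rw [hev, h] at hg
      simp at hg
    have hfin : {ε : ℂ | (CR16.genericity θ).IsRoot ε}.Finite :=
      Polynomial.finite_setOfPred_isRoot hne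
    filter_upwards [nhdsNE_le_cofinite 0 hfin.compl_mem_cofinite] with ε h1
    rw [hev]
    exact h1

  have h00 : ∀ᶠ ε in 𝓝[≠] (0 : ℂ), S ε 0 0 ≠ 0 :=
    ((hSc 0 0).eventually_ne (by simp [hS0])).filter_mono nhdsWithin_le_nhds
  have h11 : ∀ᶠ ε in 𝓝[≠] (0 : ℂ), S ε 1 1 - S ε 0 1 ^ 2 / S ε 0 0 ≠ 0 :=
    (((hSc 1 1).sub (((hSc 0 1).pow 2).div (hSc 0 0) (by simp [hS0]))).eventually_ne
      (by simp [hS0])).filter_mono nhdsWithin_le_nhds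
  have hzero : ∀ᶠ ε in 𝓝[≠] (0 : ℂ), eval (coords (affinePullback (A * gramSchmidt (S ε)) t
      (CR16.form fun i => (θ i).eval ε))) f = 0 := by
    filter_upwards [hgen, h00, h11] with ε hε h0 h1
    obtain ⟨hdet, hU⟩ := gramSchmidt_spec (hSsymm ε) h0 h1
    have hdet' : (A * gramSchmidt (S ε)).det ≠ 0 := by
      rw [Matrix.det_mul]
      exact mul_ne_zero hA hdet
    refine hf _ ⟨affinePullback_mem_YDarboux t hdet' (CR16.form_mem_YDarboux hε),
      (affinePullback_mem_poincareForms t hdet' (CR16.form_mem_V _)).2 ⟨hP ε, hQ ε, ?_⟩⟩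
    rw [← hU, Matrix.transpose_mul]
    simp only [hSdef, Matrix.mul_assoc]
  have hlim := tendsto_nhds_unique (hcont.tendsto.mono_left nhdsWithin_le_nhds)
    (tendsto_const_nhds.congr' (hzero.mono fun _ h => h.symm))
  simpa [hS0, gramSchmidt_one] using hlim

end PoincareCenter

namespace PoincareCenter

/-! ### Paths to generic parameters -/

/-- The affine path in `ℂ` from `u` at time `0` to `w` at time `1`. -/
noncomputable def linePath (u w : ℂ) : Polynomial ℂ :=
  Polynomial.C u + Polynomial.X * Polynomial.C (w - u)

@[simp]
theorem eval_zero_linePath (u w : ℂ) : (linePath u w).eval 0 = u := by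
  simp [linePath]

@[simp]
theorem eval_one_linePath (u w : ℂ) : (linePath u w).eval 1 = w := by
  simp [linePath]

theorem paramExt {θ θ' : Param → ℂ} (ha : θ .a = θ' .a) (hb : θ .b = θ' .b)
    (hc : θ .c = θ' .c) (hd : θ .d = θ' .d) (he : θ .e = θ' .e) (hk : θ .k = θ' .k)
    (hl : θ .l = θ' .l) (hm : θ .m = θ' .m) (hn : θ .n = θ' .n) (hp : θ .p = θ' .p)
    (hq : θ .q = θ' .q) : θ = θ' :=
  _root_.funext fun i => by cases i <;> assumption

theorem symmetric_of_mul_eq_one {A J : Matrix (Fin 2) (Fin 2) ℂ} (hA : A.det ≠ 0)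
    (h : A.transpose * J * A = 1) : J 0 1 - J 1 0 = 0 := by
  have h01 := congrFun (congrFun h 0) 1
  have h10 := congrFun (congrFun h 1) 0
  simp [Matrix.mul_apply, Fin.sum_univ_two] at h01 h10
  rw [Matrix.det_fin_two] at hA
  have : (J 0 1 - J 1 0) * (A 0 0 * A 1 1 - A 0 1 * A 1 0) = 0 := by
    linear_combination h01 - h10
  exact (mul_eq_zero.1 this).resolve_right hA

namespace CR16

/-- The path used when the origin is sent to the common point of the two lines. It preserves
`p = -n`, and ends at the lines `x² + y²` and the conic `z² - x y` up to a factor. -/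
noncomputable def pathZero (θ : Param → ℂ) : Param → Polynomial ℂ
  | .a => linePath (θ .a) 0
  | .b => linePath (θ .b) (-1)
  | .c => linePath (θ .c) 0
  | .d => linePath (θ .d) 0
  | .e => linePath (θ .e) 0
  | .k => linePath (θ .k) 0
  | .l => linePath (θ .l) 0
  | .m => linePath (θ .m) (-1)
  | .n => linePath (θ .n) 0
  | .p => -linePath (θ .n) 0
  | .q => linePath (θ .q) 1

/-- The path used when the origin is sent to `(1, 0)` and `a = 1`. It preserves `a = 1` and
`l = -n (1 + a + d) - q (b + e)`, and ends at the lines `x² + y²` and the conic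
`x² - y² + z²` up to a factor. -/
noncomputable def pathConic (θ : Param → ℂ) : Param → Polynomial ℂ
  | .a => 1
  | .b => linePath (θ .b) 0
  | .c => linePath (θ .c) (-1)
  | .d => linePath (θ .d) 0
  | .e => linePath (θ .e) 0
  | .k => linePath (θ .k) 0
  | .l => -(linePath (θ .n) 0 * (1 + 1 + linePath (θ .d) 0)
      + linePath (θ .q) 1 * (linePath (θ .b) 0 + linePath (θ .e) 0))
  | .m => linePath (θ .m) (-1)
  | .n => linePath (θ .n) 0
  | .p => linePath (θ .p) 0
  | .q => linePath (θ .q) 1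

/-- The path used when the origin is sent to the point `(1, 0)` of one of the lines. It preserves
`q = 0`, `p = 2 n` and `l = -n (1 + a + d)`, and ends at the lines `x y` and the conic
`x² + y² - z²` up to a factor. -/
noncomputable def pathLine (θ : Param → ℂ) : Param → Polynomial ℂ
  | .a => linePath (θ .a) (-1)
  | .b => linePath (θ .b) 0
  | .c => linePath (θ .c) (-1)
  | .d => linePath (θ .d) 0
  | .e => linePath (θ .e) 0
  | .k => linePath (θ .k) 0
  | .l => -(linePath (θ .n) (-1) * (1 + linePath (θ .a) (-1) + linePath (θ .d) 0))
  | .m => linePath (θ .m) 0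
  | .n => linePath (θ .n) (-1)
  | .p => 2 * linePath (θ .n) (-1)
  | .q => 0

theorem genericity_pathZero_ne_zero (θ : Param → ℂ) :
    genericity (fun i => (pathZero θ i).eval 1) ≠ 0 := by
  norm_num [genericity, coeffD, lineDiscr, infinityDiscr, conicDiscr, infinityResultant,
    tangencyResultant, quadResultant, coeffXZ, coeffYZ, pathZero]

theorem genericity_pathConic_ne_zero (θ : Param → ℂ) :
    genericity (fun i => (pathConic θ i).eval 1) ≠ 0 := by
  norm_num [genericity, coeffD, lineDiscr, infinityDiscr, conicDiscr, infinityResultant,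
    tangencyResultant, quadResultant, coeffXZ, coeffYZ, pathConic]

theorem genericity_pathLine_ne_zero (θ : Param → ℂ) :
    genericity (fun i => (pathLine θ i).eval 1) ≠ 0 := by
  norm_num [genericity, coeffD, lineDiscr, infinityDiscr, conicDiscr, infinityResultant,
    tangencyResultant, quadResultant, coeffXZ, coeffYZ, pathLine]

theorem genericity_X_ne_zero : genericity (X : Param → MvPolynomial Param ℂ) ≠ 0 := by
  intro h
  refine genericity_pathZero_ne_zero 0 ?_
  have h' := map_genericity (X : Param → MvPolynomial Param ℂ)
    (eval fun i => (pathZero 0 i).eval 1)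
  simpa [h] using h'.symm

theorem mem_zariskiClosure_at_zero {θ : Param → ℂ} {A : Matrix (Fin 2) (Fin 2) ℂ}
    (hA : A.det ≠ 0) (h : affinePullback A 0 (form θ) ∈ poincareForms 3) :
    affinePullback A 0 (form θ) ∈ zariskiClosure 3 (XDarboux 3 ![2, 1, 1]) := by
  obtain ⟨-, -, hJ⟩ := (affinePullback_mem_poincareForms 0 hA (form_mem_V θ)).1 h
  have hJ' := symmetric_of_mul_eq_one hA hJ
  rw [(form_at_zero θ).2.2] at hJ'
  have hθ : θ = fun i => (pathZero θ i).eval 0 := by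
    apply paramExt <;> simp [pathZero]
    linear_combination hJ'
  rw [hθ] at h
  have := mem_zariskiClosure_of_path hA 0 (pathZero θ) h (fun ε => (form_at_zero _).1)
    (fun ε => (form_at_zero _).2.1) (fun ε => sub_eq_zero.1 (by
      rw [(form_at_zero _).2.2]
      simp [pathZero])) (genericity_pathZero_ne_zero θ)
  rwa [← hθ] at this

theorem mem_zariskiClosure_at_one {θ : Param → ℂ} {A : Matrix (Fin 2) (Fin 2) ℂ}
    (hA : A.det ≠ 0) (h : affinePullback A ![1, 0] (form θ) ∈ poincareForms 3) :
    affinePullback A ![1, 0] (form θ) ∈ zariskiClosure 3 (XDarboux 3 ![2, 1, 1]) := by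
  obtain ⟨hP, hQ, hJ⟩ := (affinePullback_mem_poincareForms _ hA (form_mem_V θ)).1 h
  have hJ' := symmetric_of_mul_eq_one hA hJ
  rw [(form_at_one θ).1] at hP
  rw [(form_at_one θ).2.1] at hQ
  rw [(form_at_one θ).2.2] at hJ'
  by_cases ha : θ .a = 1
  · have hθ : θ = fun i => (pathConic θ i).eval 0 := by
      apply paramExt <;> simp [pathConic]
      · exact ha
      · rw [ha] at hQ
        linear_combination -hQ
    rw [hθ] at h
    have := mem_zariskiClosure_of_path hA ![1, 0] (pathConic θ) h
      (fun ε => by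
        rw [(form_at_one _).1]
        simp [pathConic])
      (fun ε => by
        rw [(form_at_one _).2.1]
        simp [pathConic])
      (fun ε => sub_eq_zero.1 (by
        rw [(form_at_one _).2.2]
        simp [pathConic])) (genericity_pathConic_ne_zero θ)
    rwa [← hθ] at this
  · have ha' : 1 - θ .a ≠ 0 := fun h => ha (by linear_combination -h)
    have hq : θ .q = 0 := (mul_eq_zero.1 hP).resolve_right ha'
    have hp : θ .p = 2 * θ .n := by
      have : (2 * θ .n - θ .p) * (1 - θ .a) = 0 := by linear_combination -hJ' - 3 * hQ
      linear_combination -(mul_eq_zero.1 this).resolve_right ha'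
    have hθ : θ = fun i => (pathLine θ i).eval 0 := by
      apply paramExt <;> simp [pathLine, hp, hq]
      rw [hq] at hQ
      linear_combination -hQ
    rw [hθ] at h
    have := mem_zariskiClosure_of_path hA ![1, 0] (pathLine θ) h
      (fun ε => by
        rw [(form_at_one _).1]
        simp [pathLine])
      (fun ε => by
        rw [(form_at_one _).2.1]
        simp [pathLine])
      (fun ε => sub_eq_zero.1 (by
        rw [(form_at_one _).2.2]
        simp [pathLine])) (genericity_pathLine_ne_zero θ)
    rwa [← hθ] at this

end CR16

theorem XCR16_subset_zariskiClosure :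
    XCR16 ⊆ zariskiClosure 3 (XDarboux 3 ![2, 1, 1]) := by
  rintro _ ⟨⟨θ, A, t, hA, rfl⟩, h⟩
  rcases CR16.exists_normalized θ hA t with rfl | ⟨θ', A', hA', heq⟩
  · exact CR16.mem_zariskiClosure_at_zero hA h
  · rw [heq] at h ⊢
    exact CR16.mem_zariskiClosure_at_one hA' h

end PoincareCenter

theorem mainTheorem6 :
    (∃ g : MvPolynomial PoincareCenter.Param ℂ, g ≠ 0 ∧
      ∀ θ : PoincareCenter.Param → ℂ, MvPolynomial.eval θ g ≠ 0 →
        (PoincareCenter.CR16.conic θ).IsHomogeneous 2 ∧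
        PoincareCenter.IsSmoothCurve (PoincareCenter.CR16.conic θ) ∧
        PoincareCenter.IsIntegralCurve 3 (PoincareCenter.CR16.form θ)
          (PoincareCenter.CR16.conic θ) ∧
        ∃ L₁ L₂ : PoincareCenter.Poly,
          L₁.IsHomogeneous 1 ∧ L₂.IsHomogeneous 1 ∧ LinearIndependent ℂ ![L₁, L₂] ∧
          L₁ * L₂ = PoincareCenter.CR16.linePair θ ∧
          PoincareCenter.IsIntegralCurve 3 (PoincareCenter.CR16.form θ) L₁ ∧
          PoincareCenter.IsIntegralCurve 3 (PoincareCenter.CR16.form θ) L₂ ∧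
          PoincareCenter.IsDarbouxIntegrableWith 3 (PoincareCenter.CR16.form θ)
            ![PoincareCenter.CR16.conic θ, L₁, L₂]) ∧
    PoincareCenter.XCR16 ⊆
      PoincareCenter.zariskiClosure 3 (PoincareCenter.XDarboux 3 ![2, 1, 1]) := by
  refine ⟨⟨PoincareCenter.CR16.genericity MvPolynomial.X,
    PoincareCenter.CR16.genericity_X_ne_zero, fun θ hg =>
      PoincareCenter.CR16.darbouxIntegrable_of_genericity_ne_zero ?_⟩,
    PoincareCenter.XCR16_subset_zariskiClosure⟩
  rw [PoincareCenter.CR16.map_genericity] at hg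
  simpa using hg
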